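/- Let $H$ be a separable infinite-dimensional complex Hilbert space and let $\mathcal C(H)=\mathcal B(H)/\mathcal K(H)$ be its Calkin algebra. Terminology. A *-polynomial over a unital C*-algebra $C$ is a complex linear combination of words in elements of $C$ (the coefficients), noncommuting variables $x_j$ and their formal adjoints $x_j^*$; it has degree 1 if it is a linear combination of terms $ax_jb$, $ax_j^*b$ and $a$ with $a,b\in C$. A condition over $C$ is an expression $\|P(\bar x)\|\in K$ with $P$ a *-polynomial over $C$ and $K\subseteq\mathbb R$ compact; a type is a set of conditions, and it is a degree-1 type if all its *-polynomials have degree 1. A type is realized by $\bar b$ if $\|P(\bar b)\|\in K$ for all of its conditions. It is finitely approximately realizable by elements of $S\subseteq C$ if for every finite subset $F$ of the type and every $\varepsilon>0$ there is a tuple $\bar b$ in $S$ such that $\operatorname{dist}(\|P(\bar b)\|,K)\le\varepsilon$ for all conditions in $F$. $C$ is countably quantifier-free saturated if every countable type in the variables $x_n$ ($n\in\mathbb N$) is realized in the unit ball of $C$ if and only if it is finitely approximately realizable in the unit ball of $C$. For a unital simple C*-algebra $B$, $\operatorname{Ext}(B)$ is the set of classes of unital *-homomorphisms $B\to\mathcal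 C(H)$ modulo conjugation by unitaries of $\mathcal C(H)$; it is trivial if it has exactly one element. Proposition. (1) There is a countable degree-1 type $\mathbf t$ over $\mathcal C(H)$, in one variable $x$, which is finitely approximately realizable by unitaries of $\mathcal C(H)$ but is not realized by any unitary of $\mathcal C(H)$. Moreover, $\mathbf t$ can be taken of the following form: there are a CAR algebra $A$, with unital C*-subalgebras $A_0\subseteq A_1\subseteq\cdots$ such that $A_n\cong M_{2^n}(\mathbb C)$, $\bigcup_n A_n$ is dense in $A$, and $\operatorname{Ext}(A_n)$ is trivial for all $n$; two unital *-homomorphisms $\pi_1,\pi_2\colon A\to\mathcal C(H)$ that are not conjugate by a unitary of $\mathcal C(H)$; and a countable dense set $D\subseteq A$, such that $\mathbf t$ consists of the conditions $\|x\pi_1(a)-\pi_2(a)x\|\in\{0\}$ for $a\in D$. (2) In particular, $\mathcal C(H)$ is not countably quantifier-free saturated. -/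

import Mathlib

open scoped Topology

noncomputable section

/-! ### The Calkin algebra -/

section Calkin

variable (H : Type*) [NormedAddCommGroup H] [InnerProductSpace ℂ H] [CompleteSpace H]

/-- The ideal of compact operators in `B(H)`. -/
def compactIdeal : Ideal (H →L[ℂ] H) where
  carrier := {T | IsCompactOperator T}
  add_mem' hS hT := IsCompactOperator.add hS hT
  zero_mem' := isCompactOperator_zero
  smul_mem' S _ hT := IsCompactOperator.clm_comp hT S

instance compactIdeal_isTwoSided : (compactIdeal H).IsTwoSided :=
  ⟨fun {_} S hT => IsCompactOperator.comp_clm (f := _) hT S⟩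

instance compactIdeal_isClosed : IsClosed (compactIdeal H : Set (H →L[ℂ] H)) :=
  isClosed_setOfPred_isCompactOperator

/-- The Calkin algebra `B(H)/K(H)`. -/
def Calkin : Type _ := (H →L[ℂ] H) ⧸ compactIdeal H

namespace Calkin

instance instRing : Ring (Calkin H) := Ideal.Quotient.ring (compactIdeal H)

instance instAlgebra : Algebra ℂ (Calkin H) :=
  inferInstanceAs (Algebra ℂ ((H →L[ℂ] H) ⧸ compactIdeal H))

/-- The quotient map `B(H) → B(H)/K(H)`. -/
def mk : (H →L[ℂ] H) →ₐ[ℂ] Calkin H := Ideal.Quotient.mkₐ ℂ (compactIdeal H)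

variable {H}

theorem mk_surjective : Function.Surjective (mk H) := Ideal.Quotient.mk_surjective

theorem mk_eq_mk_iff {S T : H →L[ℂ] H} : mk H S = mk H T ↔ IsCompactOperator (S - T) :=
  Ideal.Quotient.eq

/-- The quotient norm, `‖mk T‖ = inf {‖S‖ : S - T compact}`. -/
instance instNormedAddCommGroup : NormedAddCommGroup (Calkin H) :=
  inferInstanceAs (NormedAddCommGroup ((H →L[ℂ] H) ⧸ compactIdeal H))

theorem norm_mk_le (T : H →L[ℂ] H) : ‖mk H T‖ ≤ ‖T‖ :=
  Submodule.Quotient.norm_mk_le (compactIdeal H) T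

theorem exists_norm_lt (x : Calkin H) {ε : ℝ} (hε : 0 < ε) :
    ∃ T, mk H T = x ∧ ‖T‖ < ‖x‖ + ε :=
  Submodule.Quotient.norm_mk_lt (S := compactIdeal H) x hε

instance instNormedRing : NormedRing (Calkin H) :=
  { instRing H, instNormedAddCommGroup (H := H) with
    norm_mul_le := fun x y => by
      have key : ∀ ε : ℝ, 0 < ε → ‖x * y‖ ≤ (‖x‖ + ε) * (‖y‖ + ε) := by
        intro ε hε
        obtain ⟨S, rfl, hS⟩ := exists_norm_lt x hε
        obtain ⟨T, rfl, hT⟩ := exists_norm_lt y hε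
        rw [← map_mul]
        exact (norm_mk_le _).trans ((norm_mul_le S T).trans
          (mul_le_mul hS.le hT.le (norm_nonneg _) (by positivity)))
      have hlim : Filter.Tendsto (fun ε : ℝ => (‖x‖ + ε) * (‖y‖ + ε)) (𝓝[>] 0)
          (𝓝 (‖x‖ * ‖y‖)) := by
        have : Continuous fun ε : ℝ => (‖x‖ + ε) * (‖y‖ + ε) := by fun_prop
        simpa using (this.tendsto 0).mono_left nhdsWithin_le_nhds
      exact ge_of_tendsto hlim (Filter.eventually_of_mem self_mem_nhdsWithin
        fun ε hε => key ε hε) }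

instance instNormedAlgebra : NormedAlgebra ℂ (Calkin H) :=
  { instAlgebra H with
    norm_smul_le := fun c x => by
      exact (Submodule.Quotient.normedSpace (compactIdeal H) ℂ).norm_smul_le c x }

instance instCompleteSpace : CompleteSpace (Calkin H) :=
  Submodule.Quotient.completeSpace (compactIdeal H)

/-- The adjoint of a compact operator on a Hilbert space is compact. -/
theorem isCompactOperator_star {T : H →L[ℂ] H} (hT : IsCompactOperator T) :
    IsCompactOperator (star T : H →L[ℂ] H) := by
  have hTT : IsCompactOperator (T ∘ (star T : H →L[ℂ] H)) := hT.comp_clm _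
  refine (isCompactOperator_iff_isCompact_closure_image_closedBall
    ((star T : H →L[ℂ] H) : H →ₗ[ℂ] H) one_pos).2 ?_
  have h2 := (isCompactOperator_iff_isCompact_closure_image_closedBall
    ((T * star T : H →L[ℂ] H) : H →ₗ[ℂ] H) one_pos).1 hTT
  refine isCompact_iff_totallyBounded_isComplete.2
    ⟨TotallyBounded.closure ?_, isClosed_closure.isComplete⟩
  have h3 : TotallyBounded ((T * star T : H →L[ℂ] H) '' Metric.closedBall 0 1) :=
    h2.totallyBounded.subset subset_closure
  have key : ∀ x y : H, ‖(star T : H →L[ℂ] H) x - (star T : H →L[ℂ] H) y‖ ^ 2 ≤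
      ‖(T * star T : H →L[ℂ] H) x - (T * star T : H →L[ℂ] H) y‖ * ‖x - y‖ := by
    intro x y
    rw [← map_sub, ← map_sub, ContinuousLinearMap.star_eq_adjoint,
      ← inner_self_eq_norm_sq (𝕜 := ℂ), ContinuousLinearMap.adjoint_inner_right]
    exact (RCLike.re_le_norm _).trans (norm_inner_le_norm _ _)
  rw [Metric.totallyBounded_iff] at h3 ⊢
  intro ε hε
  obtain ⟨t, htf, ht⟩ := h3 (ε ^ 2 / 8) (by positivity)
  classical
  choose! g hg using fun z (hz : ∃ x ∈ Metric.closedBall (0 : H) 1,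
    (T * star T : H →L[ℂ] H) x ∈ Metric.ball z (ε ^ 2 / 8)) => hz
  refine ⟨(fun z => (star T : H →L[ℂ] H) (g z)) '' t, htf.image _, ?_⟩
  rintro _ ⟨x, hx, rfl⟩
  obtain ⟨z, hz, hxz⟩ := Set.mem_iUnion₂.1 (ht ⟨x, hx, rfl⟩)
  obtain ⟨hgz, hgz'⟩ := hg z ⟨x, hx, hxz⟩
  refine Set.mem_iUnion₂.2 ⟨_, ⟨z, hz, rfl⟩, ?_⟩
  rw [Metric.mem_ball, dist_eq_norm]
  have h4 := key x (g z)
  have h5 : ‖(T * star T : H →L[ℂ] H) x - (T * star T : H →L[ℂ] H) (g z)‖ < ε ^ 2 / 4 := by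
    rw [← dist_eq_norm]
    have := dist_triangle_right ((T * star T : H →L[ℂ] H) x) ((T * star T : H →L[ℂ] H) (g z)) z
    rw [Metric.mem_ball] at hxz hgz'
    linarith
  have h6 : ‖x - g z‖ ≤ 2 := by
    rw [mem_closedBall_zero_iff] at hx hgz
    exact (norm_sub_le _ _).trans (by linarith)
  have h7 : ‖(star T : H →L[ℂ] H) x - (star T : H →L[ℂ] H) (g z)‖ ^ 2 < ε ^ 2 := by
    nlinarith [norm_nonneg ((T * star T : H →L[ℂ] H) x - (T * star T : H →L[ℂ] H) (g z)),
      norm_nonneg (x - g z), sq_pos_of_pos hε]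
  exact lt_of_pow_lt_pow_left₀ 2 hε.le h7

/-- The involution `star (mk T) = mk (star T)`. -/
instance instStar : Star (Calkin H) :=
  ⟨Quotient.map' (s₁ := (compactIdeal H).quotientRel) (s₂ := (compactIdeal H).quotientRel) star
    fun S T h => by
      rw [Submodule.quotientRel_def] at h ⊢
      rw [← star_sub]
      exact isCompactOperator_star h⟩

theorem star_mk (T : H →L[ℂ] H) : star (mk H T) = mk H (star T) := rfl

instance instStarRing : StarRing (Calkin H) where
  star_involutive x := by
    obtain ⟨T, rfl⟩ := mk_surjective x
    simp only [star_mk, star_star]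
  star_mul x y := by
    obtain ⟨S, rfl⟩ := mk_surjective x
    obtain ⟨T, rfl⟩ := mk_surjective y
    simp only [← map_mul, star_mk, star_mul]
  star_add x y := by
    obtain ⟨S, rfl⟩ := mk_surjective x
    obtain ⟨T, rfl⟩ := mk_surjective y
    simp only [← map_add, star_mk, star_add]

instance instStarModule : StarModule ℂ (Calkin H) where
  star_smul c x := by
    obtain ⟨T, rfl⟩ := mk_surjective x
    simp only [← map_smul, star_mk, star_smul]

/-- A compact operator is nearly annihilated by the complement of a compact projection. -/
theorem exists_projection {K : H →L[ℂ] H} (hK : IsCompactOperator K) {ε : ℝ} (hε : 0 < ε) :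
    ∃ P : H →L[ℂ] H, IsCompactOperator P ∧ ‖1 - P‖ ≤ 1 ∧ IsSelfAdjoint P ∧
      ‖K * (1 - P)‖ ≤ ε := by
  have h2 := (isCompactOperator_iff_isCompact_closure_image_closedBall
    ((star K : H →L[ℂ] H) : H →ₗ[ℂ] H) one_pos).1 (isCompactOperator_star hK)
  have h3 : TotallyBounded ((star K : H →L[ℂ] H) '' Metric.closedBall 0 1) :=
    h2.totallyBounded.subset subset_closure
  obtain ⟨t, htf, ht⟩ := Metric.totallyBounded_iff.1 h3 ε hε
  let V : Submodule ℂ H := Submodule.span ℂ t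
  have : FiniteDimensional ℂ V := FiniteDimensional.span_of_finite ℂ htf
  have hsub : (1 - V.starProjection : H →L[ℂ] H) = Vᗮ.starProjection := by
    rw [Submodule.starProjection_orthogonal]; rfl
  have hsa : IsSelfAdjoint V.starProjection := isSelfAdjoint_starProjection V
  refine ⟨V.starProjection, ?_, ?_, hsa, ?_⟩
  · have : IsCompactOperator V.subtypeL :=
      isCompactOperator_of_locallyCompactSpace_rng V.subtypeL
    exact this.comp_clm V.orthogonalProjectionOnto
  · rw [hsub]; exact Submodule.starProjection_norm_le _
  · rw [← norm_star, star_mul, star_sub, star_one, hsa.star_eq]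
    refine ContinuousLinearMap.opNorm_le_of_unit_norm hε.le fun x hx => ?_
    obtain ⟨z, hz, hxz⟩ := Set.mem_iUnion₂.1 (ht ⟨x, by simp [hx], rfl⟩)
    have hzV : z ∈ V := Submodule.subset_span hz
    have : ((1 - V.starProjection) * star K : H →L[ℂ] H) x =
        Vᗮ.starProjection ((star K : H →L[ℂ] H) x - z) := by
      rw [hsub, map_sub, Submodule.starProjection_orthogonal_apply_eq_zero hzV, sub_zero]; rfl
    rw [this]
    refine (Vᗮ.starProjection.le_of_opNorm_le (Submodule.starProjection_norm_le _) _).trans ?_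
    rw [one_mul, ← dist_eq_norm]
    exact (Metric.mem_ball.1 hxz).le

/-- The Calkin algebra is a C⋆-algebra. -/
instance instCStarRing : CStarRing (Calkin H) where
  norm_mul_self_le x := by
    refine le_of_forall_pos_le_add fun ε hε => ?_
    obtain ⟨T, rfl⟩ := mk_surjective x
    obtain ⟨S, hS, hSn⟩ := exists_norm_lt (star (mk H T) * mk H T) (half_pos hε)
    rw [star_mk, ← map_mul, mk_eq_mk_iff] at hS
    obtain ⟨P, hP, hP1, hPs, hPK⟩ := exists_projection hS (half_pos hε)
    have h1 : mk H T = mk H (T * (1 - P)) := by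
      rw [mk_eq_mk_iff, mul_sub, mul_one, sub_sub_cancel]
      exact hP.clm_comp T
    have h2 : ‖T * (1 - P)‖ * ‖T * (1 - P)‖ ≤ ‖S‖ + ε / 2 := by
      rw [← CStarRing.norm_star_mul_self]
      have h3 : star (T * (1 - P)) * (T * (1 - P)) =
          (1 - P) * (S * (1 - P) - (S - star T * T) * (1 - P)) := by
        rw [star_mul, star_sub, star_one, hPs.star_eq]
        noncomm_ring
      rw [h3]
      calc ‖(1 - P) * (S * (1 - P) - (S - star T * T) * (1 - P))‖
          ≤ ‖1 - P‖ * (‖S‖ * ‖1 - P‖ + ‖(S - star T * T) * (1 - P)‖) :=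
            (norm_mul_le _ _).trans (mul_le_mul_of_nonneg_left
              ((norm_sub_le _ _).trans (add_le_add_left (norm_mul_le _ _) _)) (norm_nonneg _))
        _ ≤ 1 * (‖S‖ * 1 + ε / 2) := by gcongr
        _ = ‖S‖ + ε / 2 := by ring
    calc ‖mk H T‖ * ‖mk H T‖ ≤ ‖T * (1 - P)‖ * ‖T * (1 - P)‖ := by
          rw [h1]; exact mul_self_le_mul_self (norm_nonneg _) (norm_mk_le _)
      _ ≤ ‖S‖ + ε / 2 := h2
      _ ≤ ‖star (mk H T) * mk H T‖ + ε := by linarith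

instance instCStarAlgebra : CStarAlgebra (Calkin H) :=
  { instNormedRing (H := H), instStarRing (H := H), instCompleteSpace (H := H),
    instCStarRing (H := H), instNormedAlgebra (H := H), instStarModule (H := H) with }

end Calkin

end Calkin

/-! ### Conditions, types and saturation -/

section Types

/-- *-polynomials in the noncommuting variables `x_j`, `j : ι`, with coefficients in `A`: complex
linear combinations of words whose letters are coefficients from `A` (`Sum.inl a`), variables `x_j`
(`Sum.inr (Sum.inl j)`) and formal adjoints `x_j^*` (`Sum.inr (Sum.inr j)`). -/
abbrev StarPoly (A ι : Type*) : Type _ := FreeAlgebra ℂ (A ⊕ (ι ⊕ ι))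

namespace StarPoly

variable {A ι : Type*}

/-- A coefficient, as a constant polynomial. -/
def coeff (a : A) : StarPoly A ι := FreeAlgebra.ι ℂ (Sum.inl a)

/-- The variable `x_j`. -/
def var (j : ι) : StarPoly A ι := FreeAlgebra.ι ℂ (Sum.inr (Sum.inl j))

/-- The formal adjoint `x_j^*`. -/
def varStar (j : ι) : StarPoly A ι := FreeAlgebra.ι ℂ (Sum.inr (Sum.inr j))

/-- The value `P(b)` of a *-polynomial at a tuple `b`. -/
def eval [CStarAlgebra A] (b : ι → A) : StarPoly A ι →ₐ[ℂ] A :=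
  FreeAlgebra.lift ℂ (Sum.elim id (Sum.elim b fun j => star (b j)))

/-- Degree-1 *-polynomials: linear combinations of terms `a x_j b`, `a x_j^* b` and `a`, with
`a`, `b` in `A`. -/
def IsDegreeOne (P : StarPoly A ι) : Prop :=
  P ∈ Submodule.span ℂ
    ({Q : StarPoly A ι | ∃ a j b, Q = coeff a * var j * coeff b} ∪
      {Q | ∃ a j b, Q = coeff a * varStar j * coeff b} ∪ {Q | ∃ a, Q = coeff a})

end StarPoly

/-- A condition `‖P(x)‖ ∈ K`, where `P` is a *-polynomial and `K` is a compact set of reals. -/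
structure Condition (A ι : Type*) where
  poly : StarPoly A ι
  target : Set ℝ
  isCompact_target : IsCompact target

variable {A ι : Type*} [CStarAlgebra A]

/-- `b` `ε`-realizes the set `t` of conditions: `‖P(b)‖ ∈ K_ε` for every condition `‖P(x)‖ ∈ K`
in `t`, where `K_ε = {r : dist(r, K) ≤ ε}`. -/
def EpsRealizes (ε : ℝ) (b : ι → A) (t : Set (Condition A ι)) : Prop :=
  ∀ c ∈ t, ‖StarPoly.eval b c.poly‖ ∈ Metric.cthickening ε c.target

/-- `t` is realized by a tuple of elements of `S`. -/
def RealizedIn (S : Set A) (t : Set (Condition A ι)) : Prop :=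
  ∃ b : ι → A, (∀ j, b j ∈ S) ∧ ∀ c ∈ t, ‖StarPoly.eval b c.poly‖ ∈ c.target

/-- `t` is finitely approximately realizable by elements of `S`: each finite subset of `t` is
`ε`-realized by a tuple of elements of `S`, for each `ε > 0`. -/
def FinitelyApproxRealizableIn (S : Set A) (t : Set (Condition A ι)) : Prop :=
  ∀ F ⊆ t, F.Finite → ∀ ε : ℝ, 0 < ε → ∃ b : ι → A, (∀ j, b j ∈ S) ∧ EpsRealizes ε b F

/-- All polynomials occurring in the type `t` have degree 1. -/
def IsDegreeOneType (t : Set (Condition A ι)) : Prop := ∀ c ∈ t, c.poly.IsDegreeOne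

variable (A) in
/-- Countable quantifier-free saturation: a countable set of conditions in the variables `x_n`,
`n ∈ ℕ`, is realized in the unit ball of `A` if and only if it is finitely approximately
realizable in the unit ball of `A`. -/
def CountablyQuantifierFreeSaturated : Prop :=
  ∀ t : Set (Condition A ℕ), t.Countable →
    (RealizedIn (Metric.closedBall 0 1) t ↔ FinitelyApproxRealizableIn (Metric.closedBall 0 1) t)

/-- The 1-type consisting of the conditions `x π₁(a) = π₂(a) x`, i.e.
`‖x π₁(a) - π₂(a) x‖ ∈ {0}`, for `a ∈ D`. -/
def intertwiningType {B : Type*} (π₁ π₂ : B → A) (D : Set B) : Set (Condition A Unit) :=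
  (fun a : B =>
    { poly := StarPoly.coeff 1 * StarPoly.var () * StarPoly.coeff (π₁ a) -
        StarPoly.coeff (π₂ a) * StarPoly.var () * StarPoly.coeff 1
      target := {0}
      isCompact_target := isCompact_singleton }) '' D

end Types

/-! ### Extensions and the CAR algebra -/

section Extensions

variable (B : Type*) [Ring B] [Algebra ℂ B] [StarRing B]
variable (H : Type*) [NormedAddCommGroup H] [InnerProductSpace ℂ H] [CompleteSpace H]

/-- Unitary equivalence of (unital) extensions, i.e. of unital *-homomorphisms into the Calkin
algebra: conjugacy by a unitary of the Calkin algebra. -/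
def extSetoid : Setoid (B →⋆ₐ[ℂ] Calkin H) where
  r π₁ π₂ := ∃ u ∈ unitary (Calkin H), ∀ b, u * π₁ b * star u = π₂ b
  iseqv := by
    refine ⟨fun π => ⟨1, one_mem _, by simp⟩, ?_, ?_⟩
    · rintro π₁ π₂ ⟨u, hu, h⟩
      refine ⟨star u, Unitary.star_mem hu, fun b => ?_⟩
      rw [← h b, star_star]
      simp only [mul_assoc, Unitary.star_mul_self_of_mem hu, mul_one]
      rw [← mul_assoc, Unitary.star_mul_self_of_mem hu, one_mul]
    · rintro π₁ π₂ π₃ ⟨u, hu, h⟩ ⟨v, hv, h'⟩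
      refine ⟨v * u, mul_mem hv hu, fun b => ?_⟩
      rw [← h' b, ← h b, star_mul]
      simp only [mul_assoc]

/-- The set of classes of unital extensions of `B` by the compact operators of `H`. For simple `B`
every unital *-homomorphism into the Calkin algebra is injective, so this is `Ext(B)`. -/
def ExtClasses : Type _ := Quotient (extSetoid B H)

/-- `Ext(B)` has exactly one element. -/
def HasTrivialExt : Prop := Nonempty (ExtClasses B H) ∧ Subsingleton (ExtClasses B H)

end Extensions

/-- `S` exhibits `A` as a CAR algebra: an increasing sequence of unital *-subalgebras
`S n ≅ M_{2^n}(ℂ)` with dense union. -/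
structure IsCARTower {A : Type*} [CStarAlgebra A] (S : ℕ → StarSubalgebra ℂ A) : Prop where
  mono : Monotone S
  iso : ∀ n, Nonempty (S n ≃⋆ₐ[ℂ] Matrix (Fin (2 ^ n)) (Fin (2 ^ n)) ℂ)
  dense : Dense (⋃ n, (S n : Set A))

end

noncomputable section

/-! ### The index of operators that are invertible modulo the compact operators -/

section Index

open Module

/-! The obstruction is the Fredholm index, seen 2-adically. Let `M_N(ℂ)` act on `ℓ²` by writing a
basis index as `N q + i` and letting matrices act on the digit `i`. For `N = 2^n` these algebras
increase, and the closure of their union is a CAR algebra `A` with an obvious map `π₁` to the Calkin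
algebra. The unilateral shift gives a unitary `s` of index `-1` there, and `s^(2^n)` commutes with
`π₁(A_n)`, since it only moves `q` (`commute_shift_blockHom`).

Put `f(n) = ∑_{k<n} 4^k`. As `2^m` divides `4^m`, the conjugates of `π₁` by `s^f(n)` stabilize on
each `A_n`, so they converge pointwise to a homomorphism `π₂`. The unitaries `s^f(n)` therefore
approximately realize the intertwining type of `π₁` and `π₂`.

Suppose a unitary `w` conjugates `π₁` to `π₂`. Then `w^* s^f(n)` commutes with `π₁(A_n)`. A Fredholm
operator commuting with a copy of `M_N(ℂ)` has index divisible by `N`, because its kernel and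
cokernel are `M_N(ℂ)`-modules; averaging over matrix units gives the same modulo compact operators
(`dvd_calkinIndex_of_commute`). Hence `ind w ≡ -f(n)` modulo `2^n` for all `n`. But `f(n)` tends
2-adically to `-1/3`, so `3 ind w = 1`, which is impossible (`not_extSetoid_of_tendsto`).

Triviality of `Ext(A_n)` holds because all nonzero projections of the Calkin algebra are equivalent
(`Calkin.exists_isometry_of_isStarProjection`), and an equivalence of minimal projections spreads to
a conjugating unitary. For the failure of saturation, the two unitarity relations are added to the
type. -/

variable (H : Type*) [NormedAddCommGroup H] [InnerProductSpace ℂ H] [CompleteSpace H] in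
/-- The quotient map onto the Calkin algebra, as a *-homomorphism. -/
def Calkin.mkHom : (H →L[ℂ] H) →⋆ₐ[ℂ] Calkin H where
  toFun := Calkin.mk H
  map_one' := map_one (Calkin.mk H)
  map_mul' := map_mul (Calkin.mk H)
  map_zero' := map_zero (Calkin.mk H)
  map_add' := map_add (Calkin.mk H)
  commutes' := (Calkin.mk H).commutes'
  map_star' T := (Calkin.star_mk T).symm

theorem Calkin.mkHom_surjective {H : Type*} [NormedAddCommGroup H] [InnerProductSpace ℂ H]
    [CompleteSpace H] : Function.Surjective (Calkin.mkHom H) :=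
  Calkin.mk_surjective

/-- On `ker F`, which has finite codimension, `1 + F` is the inclusion `ι`. So `(1 + F) ∘ ι = ι`,
and additivity of the index cancels the index of `ι`. No topology is involved. -/
theorem LinearMap.index_one_add_of_finiteRange {V : Type*} [AddCommGroup V] [Module ℂ V]
    (F : V →ₗ[ℂ] V) [FiniteDimensional ℂ (LinearMap.range F)] :
    FiniteDimensional ℂ (LinearMap.ker (1 + F)) ∧
      FiniteDimensional ℂ (V ⧸ LinearMap.range (1 + F)) ∧ (1 + F).index = 0 := by
  have hk : LinearMap.ker (1 + F) ≤ LinearMap.range F := fun x hx =>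
    ⟨-x, by
      rw [LinearMap.mem_ker, LinearMap.add_apply, Module.End.one_apply] at hx
      rw [map_neg, neg_eq_iff_add_eq_zero, add_comm, hx]⟩
  have hr : LinearMap.ker F ≤ LinearMap.range (1 + F) := fun x hx =>
    ⟨x, by rw [LinearMap.add_apply, Module.End.one_apply, LinearMap.mem_ker.1 hx, add_zero]⟩
  have h1 : FiniteDimensional ℂ (LinearMap.ker (1 + F)) :=
    Submodule.finiteDimensional_of_le hk
  have h2 : FiniteDimensional ℂ (V ⧸ LinearMap.ker F) :=
    Module.Finite.equiv F.quotKerEquivRange.symm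
  have h3 : FiniteDimensional ℂ (V ⧸ LinearMap.range (1 + F)) :=
    Module.Finite.of_surjective (Submodule.factor hr) (Submodule.factor_surjective hr)
  refine ⟨h1, h3, ?_⟩
  have h4 : (1 + F) ∘ₗ (LinearMap.ker F).subtype = (LinearMap.ker F).subtype := by
    ext x
    simp [LinearMap.mem_ker.1 x.2]
  have h5 : FiniteDimensional ℂ (LinearMap.ker (LinearMap.ker F).subtype) := by
    rw [Submodule.ker_subtype]; infer_instance
  have h6 : FiniteDimensional ℂ (V ⧸ LinearMap.range (LinearMap.ker F).subtype) := by
    rw [Submodule.range_subtype]; infer_instance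
  have h7 := LinearMap.index_comp (f := (LinearMap.ker F).subtype) (1 + F)
  rw [h4] at h7
  linarith

variable {H : Type*} [NormedAddCommGroup H] [InnerProductSpace ℂ H] [CompleteSpace H]

omit [CompleteSpace H] in
-- The image of the unit ball lies within `ε` of a finite set; `K` is followed by the projection
-- onto the span of that set.
theorem IsCompactOperator.exists_finiteRange_norm_sub_le {K : H →L[ℂ] H}
    (hK : IsCompactOperator K) {ε : ℝ} (hε : 0 < ε) :
    ∃ F : H →L[ℂ] H, FiniteDimensional ℂ (LinearMap.range (F : H →ₗ[ℂ] H)) ∧ ‖K - F‖ ≤ ε := by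
  have h2 := (isCompactOperator_iff_isCompact_closure_image_closedBall
    (K : H →ₗ[ℂ] H) one_pos).1 hK
  have h3 : TotallyBounded (K '' Metric.closedBall 0 1) :=
    h2.totallyBounded.subset subset_closure
  obtain ⟨t, htf, ht⟩ := Metric.totallyBounded_iff.1 h3 ε hε
  let V : Submodule ℂ H := Submodule.span ℂ t
  have : FiniteDimensional ℂ V := FiniteDimensional.span_of_finite ℂ htf
  refine ⟨V.starProjection * K, ?_, ContinuousLinearMap.opNorm_le_of_unit_norm hε.le fun x hx => ?_⟩
  · refine Submodule.finiteDimensional_of_le (S₂ := V) ?_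
    rintro _ ⟨x, rfl⟩
    exact Submodule.starProjection_apply_mem V (K x)
  · obtain ⟨z, hz, hxz⟩ := Set.mem_iUnion₂.1 (ht ⟨x, by simp [hx], rfl⟩)
    have hzV : z ∈ V := Submodule.subset_span hz
    have h4 : (K - V.starProjection * K : H →L[ℂ] H) x = Vᗮ.starProjection (K x - z) := by
      rw [map_sub, Submodule.starProjection_orthogonal_apply_eq_zero hzV, sub_zero,
        Submodule.starProjection_orthogonal]
      rfl
    rw [h4]
    refine (Vᗮ.starProjection.le_of_opNorm_le (Submodule.starProjection_norm_le _) _).trans ?_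
    rw [one_mul, ← dist_eq_norm]
    exact (Metric.mem_ball.1 hxz).le

/-- The index of a bounded operator, as a linear map. -/
def opIndex (T : H →L[ℂ] H) : ℤ := (T : H →ₗ[ℂ] H).index

/-- Finite-dimensionality of the kernel and the cokernel. -/
def FiniteKerCoker (T : H →L[ℂ] H) : Prop :=
  FiniteDimensional ℂ (LinearMap.ker (T : H →ₗ[ℂ] H)) ∧
    FiniteDimensional ℂ (H ⧸ LinearMap.range (T : H →ₗ[ℂ] H))

omit [CompleteSpace H] in
theorem opIndex_mul {S T : H →L[ℂ] H} (hS : FiniteKerCoker S) (hT : FiniteKerCoker T) :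
    opIndex (S * T) = opIndex S + opIndex T := by
  obtain ⟨_, _⟩ := hS
  obtain ⟨_, _⟩ := hT
  exact LinearMap.index_comp (f := (T : H →ₗ[ℂ] H)) (S : H →ₗ[ℂ] H)

omit [CompleteSpace H] in
theorem FiniteKerCoker.mul {S T : H →L[ℂ] H} (hS : FiniteKerCoker S) (hT : FiniteKerCoker T) :
    FiniteKerCoker (S * T) := by
  obtain ⟨_, _⟩ := hS
  obtain ⟨_, _⟩ := hT
  constructor
  · change FiniteDimensional ℂ (LinearMap.ker ((S : H →ₗ[ℂ] H) ∘ₗ (T : H →ₗ[ℂ] H)))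
    rw [LinearMap.ker_comp]; infer_instance
  · change FiniteDimensional ℂ (H ⧸ LinearMap.range ((S : H →ₗ[ℂ] H) ∘ₗ (T : H →ₗ[ℂ] H)))
    rw [LinearMap.range_comp]; infer_instance

omit [CompleteSpace H] in
theorem finiteKerCoker_opIndex_of_isUnit {G : H →L[ℂ] H} (hG : IsUnit G) :
    FiniteKerCoker G ∧ opIndex G = 0 := by
  obtain ⟨u, rfl⟩ := hG
  have hi : Function.Injective ((u : H →L[ℂ] H) : H →ₗ[ℂ] H) := fun x y hxy => by
    have h1 := congrArg ((↑u⁻¹ : H →L[ℂ] H)) hxy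
    have h2 : ∀ z, (↑u⁻¹ : H →L[ℂ] H) ((u : H →L[ℂ] H) z) = z := fun z => by
      rw [← mul_apply_eq_comp, Units.inv_mul]; rfl
    simpa [h2] using h1
  have hs : Function.Surjective ((u : H →L[ℂ] H) : H →ₗ[ℂ] H) := fun y =>
    ⟨(↑u⁻¹ : H →L[ℂ] H) y, by
      change (u : H →L[ℂ] H) ((↑u⁻¹ : H →L[ℂ] H) y) = y
      rw [← mul_apply_eq_comp, Units.mul_inv]; rfl⟩
  have hk := LinearMap.ker_eq_bot.2 hi
  refine ⟨⟨?_, ?_⟩, ?_⟩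
  · rw [hk]; infer_instance
  · rw [LinearMap.range_eq_top.2 hs]; infer_instance
  · rw [opIndex, LinearMap.index_of_surjective hs, hk, finrank_bot]; rfl

/-- Split off a finite-rank `F` with `‖K - F‖ < 1`. Then `1 + (K - F)` is invertible by the Neumann
series, and factoring it out leaves the identity plus a finite-rank operator. -/
theorem finiteKerCoker_opIndex_one_add {K : H →L[ℂ] H} (hK : IsCompactOperator K) :
    FiniteKerCoker (1 + K) ∧ opIndex (1 + K) = 0 := by
  obtain ⟨F, hF, hFK⟩ := hK.exists_finiteRange_norm_sub_le (show (0 : ℝ) < 1 / 2 by norm_num)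
  have hG : IsUnit (1 + (K - F)) := by
    have : ‖-(K - F)‖ < 1 := by rw [norm_neg]; linarith
    rw [← sub_neg_eq_add]
    exact isUnit_one_sub_of_norm_lt_one this
  obtain ⟨u, hu⟩ := hG
  have hfac : 1 + K = (u : H →L[ℂ] H) * (1 + (↑u⁻¹ : H →L[ℂ] H) * F) := by
    rw [mul_add, mul_one, ← mul_assoc, Units.mul_inv, one_mul, hu]; abel
  have hF' : FiniteDimensional ℂ
      (LinearMap.range (((↑u⁻¹ : H →L[ℂ] H) * F : H →L[ℂ] H) : H →ₗ[ℂ] H)) := by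
    change FiniteDimensional ℂ
      (LinearMap.range (((↑u⁻¹ : H →L[ℂ] H) : H →ₗ[ℂ] H) ∘ₗ (F : H →ₗ[ℂ] H)))
    rw [LinearMap.range_comp]; infer_instance
  obtain ⟨h1, h2, h3⟩ := LinearMap.index_one_add_of_finiteRange
    (((↑u⁻¹ : H →L[ℂ] H) * F : H →L[ℂ] H) : H →ₗ[ℂ] H)
  have h4 := finiteKerCoker_opIndex_of_isUnit u.isUnit
  have h5 : FiniteKerCoker (1 + (↑u⁻¹ : H →L[ℂ] H) * F) := ⟨h1, h2⟩
  rw [hfac]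
  exact ⟨h4.1.mul h5, by rw [opIndex_mul h4.1 h5, h4.2, zero_add]; exact h3⟩

/-! ### The index modulo compact operators. -/

theorem finiteKerCoker_opIndex_of_mk_eq_one {T : H →L[ℂ] H} (hT : Calkin.mk H T = 1) :
    FiniteKerCoker T ∧ opIndex T = 0 := by
  rw [← map_one (Calkin.mk H), Calkin.mk_eq_mk_iff] at hT
  simpa using finiteKerCoker_opIndex_one_add hT

/-- If `R` lifts the inverse, then `ker T ⊆ ker (R T)` and `range (T R) ⊆ range T`, and both
products are compact perturbations of `1`. -/
theorem finiteKerCoker_of_isUnit_mk {T : H →L[ℂ] H} (hT : IsUnit (Calkin.mk H T)) :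
    FiniteKerCoker T := by
  obtain ⟨y, hy1, hy2⟩ := isUnit_iff_exists.1 hT
  obtain ⟨R, rfl⟩ := Calkin.mk_surjective y
  rw [← map_mul] at hy1 hy2
  obtain ⟨_, h1⟩ := (finiteKerCoker_opIndex_of_mk_eq_one hy1).1
  obtain ⟨h2, _⟩ := (finiteKerCoker_opIndex_of_mk_eq_one hy2).1
  constructor
  · have hk := LinearMap.ker_le_ker_comp (T : H →ₗ[ℂ] H) (R : H →ₗ[ℂ] H)
    change FiniteDimensional ℂ (LinearMap.ker ((R : H →ₗ[ℂ] H) ∘ₗ (T : H →ₗ[ℂ] H))) at h2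
    exact Submodule.finiteDimensional_of_le hk
  · change FiniteDimensional ℂ (H ⧸ LinearMap.range ((T : H →ₗ[ℂ] H) ∘ₗ (R : H →ₗ[ℂ] H))) at h1
    have hr := LinearMap.range_comp_le_range (R : H →ₗ[ℂ] H) (T : H →ₗ[ℂ] H)
    exact Module.Finite.of_surjective (Submodule.factor hr) (Submodule.factor_surjective hr)

/-- With `R` a lift of the common inverse, both indices equal `-opIndex R`. This is what makes
`calkinIndex` independent of the chosen lift. -/
theorem opIndex_congr {S T : H →L[ℂ] H} (hT : IsUnit (Calkin.mk H T))
    (h : Calkin.mk H S = Calkin.mk H T) : opIndex S = opIndex T := by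
  obtain ⟨y, hy1, hy2⟩ := isUnit_iff_exists.1 hT
  obtain ⟨R, rfl⟩ := Calkin.mk_surjective y
  have hR := finiteKerCoker_of_isUnit_mk (isUnit_iff_exists.2 ⟨_, hy2, hy1⟩)
  have hTf := finiteKerCoker_of_isUnit_mk hT
  have hSf := finiteKerCoker_of_isUnit_mk (h ▸ hT)
  have h1 := (finiteKerCoker_opIndex_of_mk_eq_one (T := T * R) (by rw [map_mul, hy1])).2
  have h2 := (finiteKerCoker_opIndex_of_mk_eq_one (T := S * R) (by rw [map_mul, h, hy1])).2
  rw [opIndex_mul hTf hR] at h1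
  rw [opIndex_mul hSf hR] at h2
  linarith

/-- The index of an element of the Calkin algebra, meaningful for invertible elements. -/
def calkinIndex (x : Calkin H) : ℤ := opIndex (Function.surjInv Calkin.mk_surjective x)

theorem calkinIndex_mk {T : H →L[ℂ] H} (hT : IsUnit (Calkin.mk H T)) :
    calkinIndex (Calkin.mk H T) = opIndex T :=
  opIndex_congr hT (Function.surjInv_eq Calkin.mk_surjective _)

theorem calkinIndex_mul {x y : Calkin H} (hx : IsUnit x) (hy : IsUnit y) :
    calkinIndex (x * y) = calkinIndex x + calkinIndex y := by
  obtain ⟨S, rfl⟩ := Calkin.mk_surjective x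
  obtain ⟨T, rfl⟩ := Calkin.mk_surjective y
  rw [← map_mul, calkinIndex_mk (by rw [map_mul]; exact hx.mul hy), calkinIndex_mk hx,
    calkinIndex_mk hy,
    opIndex_mul (finiteKerCoker_of_isUnit_mk hx) (finiteKerCoker_of_isUnit_mk hy)]

theorem calkinIndex_one : calkinIndex (1 : Calkin H) = 0 := by
  have := calkinIndex_mul (isUnit_one : IsUnit (1 : Calkin H)) isUnit_one
  rw [mul_one] at this
  linarith

theorem calkinIndex_pow {x : Calkin H} (hx : IsUnit x) (n : ℕ) :
    calkinIndex (x ^ n) = n * calkinIndex x := by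
  induction n with
  | zero => simp [calkinIndex_one]
  | succ n ih => rw [pow_succ, calkinIndex_mul (hx.pow n) hx, ih]; push_cast; ring

theorem isUnit_of_mem_unitary {R : Type*} [Monoid R] [StarMul R] {u : R} (hu : u ∈ unitary R) :
    IsUnit u :=
  isUnit_iff_exists.2 ⟨star u, Unitary.mul_star_self_of_mem hu, Unitary.star_mul_self_of_mem hu⟩

theorem calkinIndex_star {u : Calkin H} (hu : u ∈ unitary (Calkin H)) :
    calkinIndex (star u) = -calkinIndex u := by
  have := calkinIndex_mul (isUnit_of_mem_unitary hu) (isUnit_of_mem_unitary (Unitary.star_mem hu))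
  rw [Unitary.mul_star_self_of_mem hu, calkinIndex_one] at this
  linarith

end Index

/-! ### Divisibility of the index in the commutant of a matrix algebra -/

section Divisibility

open Module

/-- A finite-dimensional space that decomposes into `N` copies of the range of an idempotent has
dimension divisible by `N`. -/
theorem dvd_finrank_of_sum_mul_eq_one {V : Type*} [AddCommGroup V] [Module ℂ V]
    [FiniteDimensional ℂ V] {N : ℕ} (a b : Fin N → End ℂ V) (p : End ℂ V)
    (hp : IsIdempotentElem p) (hba : ∀ i, b i * a i = p) (hab : ∑ i, a i * b i = 1) :
    N ∣ finrank ℂ V := by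
  -- By cyclicity each `a i * b i` has the trace of `p`, which is its rank.
  have h1 : LinearMap.trace ℂ V (∑ i, a i * b i) = N * finrank ℂ (LinearMap.range p) := by
    rw [map_sum, Finset.sum_congr rfl fun i _ => by rw [LinearMap.trace_mul_comm, hba i],
      LinearMap.IsIdempotentElem.isProj_range p hp |>.trace]
    simp
  rw [hab, LinearMap.trace_one] at h1
  exact ⟨_, by exact_mod_cast h1⟩

variable {H : Type*} [NormedAddCommGroup H] [InnerProductSpace ℂ H] [CompleteSpace H]

omit [CompleteSpace H] in
-- The matrix units act on the kernel and on the cokernel of `X`, and each of these is `N` copies of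
-- its corner under `e 0 0`.
theorem dvd_opIndex_of_commute {N : ℕ} [NeZero N] (φ : Matrix (Fin N) (Fin N) ℂ →ₐ[ℂ] (H →L[ℂ] H))
    {X : H →L[ℂ] H} (hX : FiniteKerCoker X) (hc : ∀ M, Commute X (φ M)) :
    (N : ℤ) ∣ opIndex X := by
  obtain ⟨_, _⟩ := hX
  have hc' : ∀ M x, X (φ M x) = φ M (X x) := fun M x => congrArg (fun T : H →L[ℂ] H => T x) (hc M)
  have hk : ∀ M, ∀ x ∈ LinearMap.ker (X : H →ₗ[ℂ] H),
      ((φ M : H →L[ℂ] H) : H →ₗ[ℂ] H) x ∈ LinearMap.ker (X : H →ₗ[ℂ] H) := fun M x hx => by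
    change X (φ M x) = 0
    rw [hc', show X x = 0 from hx, map_zero]
  have hr : ∀ M, LinearMap.range (X : H →ₗ[ℂ] H) ≤
      (LinearMap.range (X : H →ₗ[ℂ] H)).comap ((φ M : H →L[ℂ] H) : H →ₗ[ℂ] H) := by
    rintro M _ ⟨x, rfl⟩
    exact ⟨φ M x, hc' M x⟩
  let e : Fin N → Fin N → Matrix (Fin N) (Fin N) ℂ := fun i j => Matrix.single i j 1
  have he : ∀ i j k, e i j * e j k = e i k := fun i j k => by simp [e]
  have hφ : ∀ i j k x, φ (e i j) (φ (e j k) x) = φ (e i k) x := fun i j k x => by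
    rw [← he i j k, map_mul]; rfl
  have hsum : ∀ x, ∑ i, φ (e i 0) (φ (e 0 i) x) = x := fun x => by
    have h1 : ∑ i, e i i = 1 := by
      simp only [e]
      exact Matrix.sum_single_one
    simp only [hφ]
    rw [← sum_apply, ← map_sum, h1, map_one]; rfl
  refine dvd_sub ?_ ?_
  · refine Int.natCast_dvd_natCast.2 (dvd_finrank_of_sum_mul_eq_one
      (fun i => LinearMap.restrict _ (hk (e i 0))) (fun i => LinearMap.restrict _ (hk (e 0 i)))
      (LinearMap.restrict _ (hk (e 0 0))) ?_ ?_ ?_)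
    · ext x; exact hφ 0 0 0 x
    · intro i; ext x; exact hφ 0 i 0 x
    · ext x
      simpa [LinearMap.sum_apply] using hsum x
  · refine Int.natCast_dvd_natCast.2 (dvd_finrank_of_sum_mul_eq_one
      (fun i => Submodule.mapQ _ _ _ (hr (e i 0))) (fun i => Submodule.mapQ _ _ _ (hr (e 0 i)))
      (Submodule.mapQ _ _ _ (hr (e 0 0))) ?_ ?_ ?_)
    · ext x; exact congrArg (Submodule.mkQ _) (hφ 0 0 0 x)
    · intro i; ext x; exact congrArg (Submodule.mkQ _) (hφ 0 i 0 x)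
    · ext x
      simpa [LinearMap.sum_apply] using congrArg (Submodule.mkQ (LinearMap.range (X : H →ₗ[ℂ] H))) (hsum x)

/-- Commutation is only known modulo compacts, so a lift need not commute with `φ`. It is replaced
by a lift that does, to which the Hilbert space statement applies. -/
theorem dvd_calkinIndex_of_commute {N : ℕ} [NeZero N]
    (φ : Matrix (Fin N) (Fin N) ℂ →ₐ[ℂ] (H →L[ℂ] H)) {x : Calkin H} (hx : IsUnit x)
    (hc : ∀ M, Commute x (Calkin.mkHom H (φ M))) : (N : ℤ) ∣ calkinIndex x := by
  obtain ⟨T, rfl⟩ := Calkin.mkHom_surjective x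
  let e : Fin N → Fin N → Matrix (Fin N) (Fin N) ℂ := fun i j => Matrix.single i j 1
  have he : ∀ i j k, e i j * e j k = e i k := fun i j k => by simp [e]
  have he' : ∀ i j k l, j ≠ k → e i j * e k l = 0 := fun i j k l h =>
    Matrix.single_mul_single_of_ne (1 : ℂ) i j k h 1
  have hsum : ∑ i, e i i = 1 := Matrix.sum_single_one
  -- Copying the `(0, 0)` corner of `T` along the diagonal forces exact commutation. Modulo compacts
  -- nothing changes, since there `T` already commutes with the matrix units.
  let X : H →L[ℂ] H := ∑ i, φ (e i 0) * T * φ (e 0 i)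
  have hXT : Calkin.mkHom H X = Calkin.mkHom H T := by
    have h1 : ∀ i, Calkin.mkHom H (φ (e i 0) * T * φ (e 0 i)) =
        Calkin.mkHom H (φ (e i i) * T) := fun i => by
      rw [map_mul, map_mul, mul_assoc, (hc _).eq, ← he i 0 i, map_mul φ, map_mul, map_mul,
        mul_assoc]
    have h2 : T = ∑ i, φ (e i i) * T := by
      rw [← Finset.sum_mul, ← map_sum, hsum, map_one, one_mul]
    conv_rhs => rw [h2]
    rw [map_sum, map_sum]
    exact Finset.sum_congr rfl fun i _ => h1 i
  have hXu : IsUnit (Calkin.mkHom H X) := hXT ▸ hx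
  have hXu' : IsUnit (Calkin.mk H X) := hXu
  rw [← hXT]
  refine (calkinIndex_mk hXu').symm ▸ dvd_opIndex_of_commute φ
    (finiteKerCoker_of_isUnit_mk hXu') fun M => ?_
  have hs : ∀ k l, Commute X (φ (e k l)) := fun k l => by
    have h1 : X * φ (e k l) = φ (e k 0) * T * φ (e 0 l) := by
      rw [Finset.sum_mul, Finset.sum_eq_single k]
      · rw [mul_assoc, ← map_mul, he]
      · intro i _ hi
        rw [mul_assoc, ← map_mul, he' _ _ _ _ hi, map_zero, mul_zero]
      · simp
    have h2 : φ (e k l) * X = φ (e k 0) * T * φ (e 0 l) := by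
      rw [Finset.mul_sum, Finset.sum_eq_single l]
      · rw [← mul_assoc, ← mul_assoc, ← map_mul, he]
      · intro i _ hi
        rw [← mul_assoc, ← mul_assoc, ← map_mul, he' _ _ _ _ hi.symm,
          map_zero, zero_mul, zero_mul]
      · simp
    exact h1.trans h2.symm
  rw [Matrix.matrix_eq_sum_single M, map_sum]
  refine Commute.sum_right _ _ _ fun i _ => ?_
  rw [map_sum]
  refine Commute.sum_right _ _ _ fun j _ => ?_
  have : Matrix.single i j (M i j) = M i j • e i j := by simp [e, Matrix.smul_single]
  rw [this, map_smul]
  exact (hs i j).smul_right _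

end Divisibility

/-! ### Projections in the Calkin algebra -/

section Projections

open Module

theorem Orthonormal.countable_of_separable {H ι : Type*} [NormedAddCommGroup H]
    [InnerProductSpace ℂ H] [TopologicalSpace.SeparableSpace H] {v : ι → H}
    (hv : Orthonormal ℂ v) : Countable ι := by
  have hd : (Set.univ : Set ι).PairwiseDisjoint fun i => Metric.ball (v i) (1 / 2) := by
    intro i _ j _ hij
    refine Metric.ball_disjoint_ball ?_
    have h1 : ‖v i - v j‖ ^ 2 = 2 := by
      rw [@norm_sub_sq ℂ, hv.1 i, hv.1 j, hv.2 hij]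
      norm_num
    rw [dist_eq_norm]
    nlinarith [norm_nonneg (v i - v j)]
  exact Set.countable_univ_iff.1 (hd.countable_of_isOpen (fun _ _ => Metric.isOpen_ball)
    fun i _ => ⟨v i, Metric.mem_ball_self (by norm_num)⟩)

theorem exists_hilbertBasis_nat (H : Type*) [NormedAddCommGroup H] [InnerProductSpace ℂ H]
    [CompleteSpace H] [TopologicalSpace.SeparableSpace H] (hH : ¬ FiniteDimensional ℂ H) :
    Nonempty (HilbertBasis ℕ ℂ H) := by
  obtain ⟨w, b, -⟩ := exists_hilbertBasis ℂ H
  have hc : Countable w := b.orthonormal.countable_of_separable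
  have hi : Infinite w := by
    by_contra hf
    rw [not_infinite_iff_finite] at hf
    have := Fintype.ofFinite w
    exact hH b.toOrthonormalBasis.toBasis.finiteDimensional_of_finite
  obtain ⟨e⟩ := nonempty_equiv_of_countable (α := ℕ) (β := w)
  refine ⟨HilbertBasis.mk (v := b ∘ e) (b.orthonormal.comp _ e.injective) ?_⟩
  rw [Set.range_comp, e.surjective.range_eq, Set.image_univ, b.dense_span]

/-- Eigenvectors for distinct eigenvalues are orthogonal, and orthonormal families in a separable
space are countable. -/
theorem LinearMap.IsSymmetric.countable_hasEigenvalue {H : Type*} [NormedAddCommGroup H]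
    [InnerProductSpace ℂ H] [TopologicalSpace.SeparableSpace H] {S : H →ₗ[ℂ] H}
    (hS : S.IsSymmetric) : {μ : ℂ | End.HasEigenvalue S μ}.Countable := by
  choose v hv using fun μ : {μ : ℂ | End.HasEigenvalue S μ} => μ.2.exists_hasEigenvector
  have hv0 : ∀ μ, v μ ≠ 0 := fun μ => (hv μ).2
  have ho : Orthonormal ℂ fun μ => ((‖v μ‖ : ℂ)⁻¹) • v μ := by
    refine ⟨fun μ => ?_, fun μ ν hμν => ?_⟩
    · rw [norm_smul, norm_inv, Complex.norm_real, norm_norm,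
        inv_mul_cancel₀ (norm_ne_zero_iff.2 (hv0 μ))]
    · have h1 := hS.orthogonalFamily_eigenspaces (i := μ.1) (j := ν.1)
        (fun h => hμν (Subtype.ext h)) ⟨v μ, (hv μ).1⟩ ⟨v ν, (hv ν).1⟩
      change inner ℂ (v μ) (v ν) = 0 at h1
      simp only [inner_smul_left, inner_smul_right, h1, mul_zero]
  exact Set.countable_coe_iff.1 ho.countable_of_separable

/-! ### Lifting projections from the Calkin algebra. -/

variable {H : Type*} [NormedAddCommGroup H] [InnerProductSpace ℂ H] [CompleteSpace H]

theorem Calkin.exists_selfAdjoint_lift {x : Calkin H} (hx : IsSelfAdjoint x) :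
    ∃ T : H →L[ℂ] H, IsSelfAdjoint T ∧ Calkin.mkHom H T = x := by
  obtain ⟨T, rfl⟩ := Calkin.mkHom_surjective x
  refine ⟨(realPart T : H →L[ℂ] H), (realPart T).2, ?_⟩
  rw [realPart_apply_coe, ← Complex.coe_smul, map_smul, map_add, map_star, hx.star_eq,
    ← two_smul ℂ, smul_smul]
  norm_num

/-- A self-adjoint operator with compact `T - T ^ 2` has a spectral gap in `(0, 1)`. -/
theorem exists_not_mem_spectrum_of_isCompactOperator [TopologicalSpace.SeparableSpace H]
    {T : H →L[ℂ] H} (hT : IsSelfAdjoint T) (hc : IsCompactOperator (T - T * T)) :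
    ∃ c : ℝ, 0 < c ∧ c < 1 ∧ c ∉ spectrum ℝ T := by
  have hsa : IsSelfAdjoint (T - T * T) := by
    refine hT.sub ?_
    rw [IsSelfAdjoint, star_mul, hT.star_eq]
  have hsym : ((T - T * T : H →L[ℂ] H) : H →ₗ[ℂ] H).IsSymmetric :=
    ContinuousLinearMap.isSelfAdjoint_iff_isSymmetric.1 hsa
  have hcount := hsym.countable_hasEigenvalue
  -- The other preimage of `c - c * c` is `1 - c`, hence the restriction to `c < 1 / 2`. An
  -- uncountable interval then maps injectively, so some value avoids the countable set of
  -- eigenvalues.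
  have hinj : Set.InjOn (fun c : ℝ => ((c - c * c : ℝ) : ℂ)) (Set.Ioo 0 (1 / 2)) := by
    intro a ha b hb hab
    have h1 : a - a * a = b - b * b := Complex.ofReal_injective hab
    have h2 : (a - b) * (1 - (a + b)) = 0 := by linear_combination h1
    rcases mul_eq_zero.1 h2 with h | h
    · linarith
    · linarith [ha.2, hb.2]
  have hex : ∃ c ∈ Set.Ioo (0 : ℝ) (1 / 2),
      ¬ End.HasEigenvalue ((T - T * T : H →L[ℂ] H) : H →ₗ[ℂ] H) ((c - c * c : ℝ) : ℂ) := by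
    by_contra! hall
    have h1 : (Set.Ioo (0 : ℝ) (1 / 2)).Countable :=
      Set.MapsTo.countable_of_injOn
        (show Set.MapsTo (fun c : ℝ => ((c - c * c : ℝ) : ℂ)) _ _ from fun c hc => hall c hc)
        hinj hcount
    exact (Cardinal.Real.Ioo_countable_iff.1 h1).not_gt (by norm_num)
  obtain ⟨c, hc0, hce⟩ := hex
  refine ⟨c, hc0.1, by linarith [hc0.2], ?_⟩
  have hne : ((c - c * c : ℝ) : ℂ) ≠ 0 := by
    rw [Complex.ofReal_ne_zero]
    nlinarith [hc0.1, hc0.2]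
  -- Fredholm alternative: a nonzero number that is not an eigenvalue of a compact operator is in
  -- its resolvent set. The commuting factorization below passes invertibility on to `c - T`.
  have hres := (hc.hasEigenvalue_or_mem_resolventSet hne).resolve_left hce
  rw [spectrum.mem_resolventSet_iff] at hres
  rw [spectrum.notMem_iff]
  have hfac : algebraMap ℂ (H →L[ℂ] H) ((c - c * c : ℝ) : ℂ) - (T - T * T) =
      (algebraMap ℝ (H →L[ℂ] H) c - T) * (algebraMap ℝ (H →L[ℂ] H) (1 - c) - T) := by
    have h1 : algebraMap ℂ (H →L[ℂ] H) ((c - c * c : ℝ) : ℂ) =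
        algebraMap ℝ (H →L[ℂ] H) (c - c * c) := by
      rw [Algebra.algebraMap_eq_smul_one, Algebra.algebraMap_eq_smul_one, Complex.coe_smul]
    rw [h1]
    simp only [map_sub, map_mul, map_one]
    have h2 := Algebra.commutes c T
    simp only [sub_mul, mul_sub, mul_one, h2]
    abel
  have hcom : Commute (algebraMap ℝ (H →L[ℂ] H) c - T) (algebraMap ℝ (H →L[ℂ] H) (1 - c) - T) :=
    ((Algebra.commute_algebraMap_left _ _).sub_right (Algebra.commute_algebraMap_left _ _)).sub_left
      ((Algebra.commute_algebraMap_right _ _).sub_right (Commute.refl T))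
  rw [hfac, hcom.isUnit_mul_iff] at hres
  exact hres.1

/-- A self-adjoint lift has a spectral gap at some `c` in `(0, 1)`, so the step function at `c` is
continuous on its spectrum and yields a projection. On the spectrum of `p`, inside `{0, 1}`, the
step function is the identity, so the image is still `p`. -/
theorem Calkin.exists_isStarProjection_lift [TopologicalSpace.SeparableSpace H] {p : Calkin H}
    (hp : IsStarProjection p) : ∃ P : H →L[ℂ] H, IsStarProjection P ∧ Calkin.mkHom H P = p := by
  obtain ⟨T, hT, rfl⟩ := Calkin.exists_selfAdjoint_lift hp.isSelfAdjoint
  have hc : IsCompactOperator (T - T * T) := by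
    refine Calkin.mk_eq_mk_iff.1 (?_ : Calkin.mkHom H T = Calkin.mkHom H (T * T))
    rw [map_mul]
    exact hp.isIdempotentElem.eq.symm
  obtain ⟨c, hc0, hc1, hcs⟩ := exists_not_mem_spectrum_of_isCompactOperator hT hc
  let f : ℝ → ℝ := fun t => if c < t then 1 else 0
  have hf : ContinuousOn f (spectrum ℝ T) := by
    intro t ht
    have htc : t ≠ c := fun h => hcs (h ▸ ht)
    refine ContinuousAt.continuousWithinAt ?_
    rcases lt_or_gt_of_ne htc with h | h
    · refine continuousAt_const (y := (0 : ℝ)) |>.congr ?_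
      filter_upwards [Iio_mem_nhds h] with s hs
      exact (if_neg (not_lt.2 (le_of_lt hs))).symm
    · refine continuousAt_const (y := (1 : ℝ)) |>.congr ?_
      filter_upwards [Ioi_mem_nhds h] with s hs
      exact (if_pos hs).symm
  refine ⟨cfc f T, ⟨?_, cfc_predicate f T⟩, ?_⟩
  · rw [IsIdempotentElem, ← cfc_mul f f T hf hf]
    refine cfc_congr fun t _ => ?_
    simp only [f]
    split_ifs <;> norm_num
  · rw [StarAlgHomClass.map_cfc (S := ℂ) (Calkin.mkHom H) f T hf
      (AddMonoidHomClass.continuous_of_bound (Calkin.mkHom H) 1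
        fun S => by rw [one_mul]; exact Calkin.norm_mk_le S) hT hp.isSelfAdjoint]
    conv_rhs => rw [← cfc_id ℝ (Calkin.mkHom H T) hp.isSelfAdjoint]
    refine cfc_congr fun t ht => ?_
    rcases hp.isIdempotentElem.spectrum_subset ℝ ht with h | h
    · simp [f, h, hc0.le]
    · rw [Set.mem_singleton_iff] at h
      simp [f, h, hc1]

/-- Every nonzero projection of the Calkin algebra is Murray-von Neumann equivalent to `1`. -/
theorem Calkin.exists_isometry_of_isStarProjection [TopologicalSpace.SeparableSpace H]
    {p : Calkin H} (hp : IsStarProjection p) (hp0 : p ≠ 0) :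
    ∃ w : Calkin H, star w * w = 1 ∧ w * star w = p := by
  obtain ⟨P, hP, rfl⟩ := Calkin.exists_isStarProjection_lift hp
  obtain ⟨K, hK, hPK⟩ := isStarProjection_iff_eq_starProjection.1 hP
  have hcK : CompleteSpace K := by
    have h1 : IsClosed (K : Set H) :=
      K.orthogonal_orthogonal ▸ Submodule.isClosed_orthogonal Kᗮ
    exact h1.completeSpace_coe
  -- A finite-rank `P` would be compact and give `p = 0`. So `K` and `H` both have bases indexed by
  -- `ℕ`, and `W` can be an isometry of `H` onto `K`.
  have hinf : ¬ FiniteDimensional ℂ K := fun hfin => hp0 (by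
    rw [← map_zero (Calkin.mkHom H)]
    refine Calkin.mk_eq_mk_iff.2 ?_
    rw [sub_zero, hPK]
    have : IsCompactOperator K.subtypeL :=
      isCompactOperator_of_locallyCompactSpace_rng K.subtypeL
    exact this.comp_clm K.orthogonalProjectionOnto)
  have hinf' : ¬ FiniteDimensional ℂ H := fun hfin => hinf inferInstance
  obtain ⟨b⟩ := exists_hilbertBasis_nat H hinf'
  obtain ⟨b'⟩ := exists_hilbertBasis_nat K hinf
  let L : H ≃ₗᵢ[ℂ] K := b.repr.trans b'.repr.symm
  let W : H →L[ℂ] H := K.subtypeL ∘L (L : H →L[ℂ] K)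
  have hW : star W = (L.symm : K →L[ℂ] H) ∘L K.orthogonalProjectionOnto := by
    rw [ContinuousLinearMap.star_eq_adjoint, ContinuousLinearMap.adjoint_comp]
    congr 1
    · exact L.adjoint_eq_symm
    · exact K.adjoint_subtypeL
  refine ⟨Calkin.mkHom H W, ?_, ?_⟩
  · rw [← map_star, ← map_mul, ← map_one (Calkin.mkHom H), hW]
    congr 1
    ext x
    simp [W]
  · rw [← map_star, ← map_mul, hW, hPK]
    congr 1
    ext x
    simp [W]

end Projections

/-! ### Representations of matrix algebras in the Calkin algebra -/

section MatrixExt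

/-- The partial isometry `w` between the corners at index `0` is transported to the other diagonal
positions by matrix units, and the pieces are added up. -/
theorem exists_unitary_conj_of_matrix {R : Type*} [Ring R] [Algebra ℂ R] [StarRing R] {N : ℕ}
    [NeZero N] (π π' : Matrix (Fin N) (Fin N) ℂ →⋆ₐ[ℂ] R) {w : R}
    (h1 : star w * w = π (Matrix.single 0 0 1)) (h2 : w * star w = π' (Matrix.single 0 0 1)) :
    ∃ u ∈ unitary R, ∀ M, u * π M * star u = π' M := by
  let e : Fin N → Fin N → Matrix (Fin N) (Fin N) ℂ := fun i j => Matrix.single i j 1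
  have he : ∀ i j k, e i j * e j k = e i k := fun i j k => by simp [e]
  have he' : ∀ i j k l, j ≠ k → e i j * e k l = 0 := fun i j k l h =>
    Matrix.single_mul_single_of_ne (1 : ℂ) i j k h 1
  have hes : ∀ i j, star (e i j) = e j i := fun i j => by
    simp [e, Matrix.star_eq_conjTranspose]
  have hsum : ∑ i, e i i = 1 := Matrix.sum_single_one
  have h1' : star w * w = π (e 0 0) := h1
  have h2' : w * star w = π' (e 0 0) := h2
  let u : R := ∑ i, π' (e i 0) * w * π (e 0 i)
  have hu : star u = ∑ i, π (e i 0) * star w * π' (e 0 i) := by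
    simp only [u, star_sum, star_mul, ← map_star, hes, mul_assoc]
  have hw1 : w * π (e 0 0) * star w = π' (e 0 0) := by
    rw [← h1', ← mul_assoc, h2', mul_assoc, h2', ← map_mul, he]
  have hw2 : star w * π' (e 0 0) * w = π (e 0 0) := by
    rw [← h2', ← mul_assoc, h1', mul_assoc, h1', ← map_mul, he]
  -- Stated for arbitrary `ρ`, `σ`, `v` so that exchanging the representations and replacing `w` by
  -- `star w` also gives `star u * u = 1`.
  have key : ∀ (ρ σ : Matrix (Fin N) (Fin N) ℂ →⋆ₐ[ℂ] R) (v : R),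
      v * ρ (e 0 0) * star v = σ (e 0 0) →
      (∑ i, σ (e i 0) * v * ρ (e 0 i)) * (∑ j, ρ (e j 0) * star v * σ (e 0 j)) = 1 := by
    intro ρ σ v hv
    rw [Finset.sum_mul, ← map_one σ, ← hsum, map_sum]
    refine Finset.sum_congr rfl fun i _ => ?_
    rw [Finset.mul_sum, Finset.sum_eq_single i]
    · calc σ (e i 0) * v * ρ (e 0 i) * (ρ (e i 0) * star v * σ (e 0 i))
          = σ (e i 0) * (v * (ρ (e 0 i) * ρ (e i 0)) * star v) * σ (e 0 i) := by
            simp only [mul_assoc]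
        _ = σ (e i i) := by
            rw [← map_mul, he, hv, ← map_mul, ← map_mul, he, he]
    · intro j _ hj
      calc σ (e i 0) * v * ρ (e 0 i) * (ρ (e j 0) * star v * σ (e 0 j))
          = σ (e i 0) * v * (ρ (e 0 i) * ρ (e j 0)) * star v * σ (e 0 j) := by
            simp only [mul_assoc]
        _ = 0 := by rw [← map_mul, he' _ _ _ _ hj.symm, map_zero]; simp
    · simp
  have huu : u * star u = 1 := by rw [hu]; exact key π π' w hw1
  have huu' : star u * u = 1 := by
    rw [hu]
    have := key π' π (star w) (by rw [star_star]; exact hw2)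
    rwa [star_star] at this
  refine ⟨u, Unitary.mem_iff.2 ⟨huu', huu⟩, fun M => ?_⟩
  have hs : ∀ k l, u * π (e k l) = π' (e k l) * u := fun k l => by
    have h3 : u * π (e k l) = π' (e k 0) * w * π (e 0 l) := by
      rw [Finset.sum_mul, Finset.sum_eq_single k]
      · rw [mul_assoc, ← map_mul, he]
      · intro i _ hi
        rw [mul_assoc, ← map_mul, he' _ _ _ _ hi, map_zero, mul_zero]
      · simp
    have h4 : π' (e k l) * u = π' (e k 0) * w * π (e 0 l) := by
      rw [Finset.mul_sum, Finset.sum_eq_single l]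
      · rw [← mul_assoc, ← mul_assoc, ← map_mul, he]
      · intro i _ hi
        rw [← mul_assoc, ← mul_assoc, ← map_mul, he' _ _ _ _ hi.symm,
          map_zero, zero_mul, zero_mul]
      · simp
    rw [h3, h4]
  have hM : u * π M = π' M * u := by
    have hsingle : ∀ i j, Matrix.single i j (M i j) = M i j • e i j := fun i j => by
      simp [e, Matrix.smul_single]
    rw [Matrix.matrix_eq_sum_single M]
    simp only [hsingle, map_sum, map_smul, Finset.mul_sum, Finset.sum_mul, mul_smul_comm,
      smul_mul_assoc, hs]
  rw [hM, mul_assoc, huu, mul_one]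

/-! ### Conjugacy of matrix representations in the Calkin algebra. -/

variable {H : Type*} [NormedAddCommGroup H] [InnerProductSpace ℂ H] [CompleteSpace H]

theorem Calkin.nontrivial (hH : ¬ FiniteDimensional ℂ H) : Nontrivial (Calkin H) := by
  refine ⟨Calkin.mk H 1, Calkin.mk H 0, fun h => hH ?_⟩
  rw [Calkin.mk_eq_mk_iff, sub_zero] at h
  exact FiniteDimensional.of_isCompactOperator_id (𝕜 := ℂ) h

theorem matrix_single_isStarProjection {N : ℕ} (i : Fin N) :
    IsStarProjection (Matrix.single i i (1 : ℂ)) :=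
  ⟨by simp [IsIdempotentElem], by simp [IsSelfAdjoint, Matrix.star_eq_conjTranspose]⟩

theorem StarAlgHom.matrix_single_ne_zero {R : Type*} [Ring R] [Algebra ℂ R] [StarRing R]
    [Nontrivial R] {N : ℕ} (π : Matrix (Fin N) (Fin N) ℂ →⋆ₐ[ℂ] R) (i : Fin N) :
    π (Matrix.single i i 1) ≠ 0 := by
  have : NeZero N := ⟨fun h => (h ▸ i).elim0⟩
  have hinj : Function.Injective π := (π : Matrix (Fin N) (Fin N) ℂ →+* R).injective
  rw [← map_zero π]
  refine hinj.ne fun h => ?_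
  simpa using congrFun (congrFun h i) i

theorem Calkin.exists_unitary_conj_of_matrix [TopologicalSpace.SeparableSpace H]
    (hH : ¬ FiniteDimensional ℂ H) {N : ℕ} [NeZero N]
    (π π' : Matrix (Fin N) (Fin N) ℂ →⋆ₐ[ℂ] Calkin H) :
    ∃ u ∈ unitary (Calkin H), ∀ M, u * π M * star u = π' M := by
  have := Calkin.nontrivial hH
  have hsp := matrix_single_isStarProjection (0 : Fin N)
  obtain ⟨v, hv1, hv2⟩ := Calkin.exists_isometry_of_isStarProjection (hsp.map π)
    (π.matrix_single_ne_zero 0)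
  obtain ⟨v', hv1', hv2'⟩ := Calkin.exists_isometry_of_isStarProjection (hsp.map π')
    (π'.matrix_single_ne_zero 0)
  -- Both corner projections are equivalent to `1`, hence to each other through `v' * star v`.
  refine _root_.exists_unitary_conj_of_matrix π π' (w := v' * star v) ?_ ?_
  · rw [star_mul, star_star, mul_assoc, ← mul_assoc (star v'), hv1', one_mul, hv2]
  · rw [star_mul, star_star, mul_assoc, ← mul_assoc (star v), hv1, one_mul, hv2']

theorem hasTrivialExt_of_matrix [TopologicalSpace.SeparableSpace H]
    (hH : ¬ FiniteDimensional ℂ H) {N : ℕ} [NeZero N] {B : Type*} [Ring B] [Algebra ℂ B]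
    [StarRing B] (e : B ≃⋆ₐ[ℂ] Matrix (Fin N) (Fin N) ℂ) (π : B →⋆ₐ[ℂ] Calkin H) :
    HasTrivialExt B H := by
  refine ⟨⟨Quotient.mk _ π⟩, ⟨?_⟩⟩
  rintro ⟨π₁⟩ ⟨π₂⟩
  refine Quotient.sound ?_
  obtain ⟨u, hu, h⟩ := Calkin.exists_unitary_conj_of_matrix hH
    (π₁.comp e.symm.toStarAlgHom) (π₂.comp e.symm.toStarAlgHom)
  exact ⟨u, hu, fun b => by simpa using h (e b)⟩

end MatrixExt

/-! ### Isometries permuting a Hilbert basis -/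

section BasisIsometry

variable {H : Type*} [NormedAddCommGroup H] [InnerProductSpace ℂ H] [CompleteSpace H]
  (b : HilbertBasis ℕ ℂ H)

omit [CompleteSpace H] in
theorem HilbertBasis.clm_ext {E : Type*} [NormedAddCommGroup E] [InnerProductSpace ℂ E]
    {S T : H →L[ℂ] E} (h : ∀ k, S (b k) = T (b k)) : S = T :=
  ContinuousLinearMap.ext_on (Submodule.dense_iff_topologicalClosure_eq_top.2 b.dense_span)
    (by rintro _ ⟨k, rfl⟩; exact h k)

/-- The isometry `b k ↦ b (f k)`. -/
def basisIsometry (f : ℕ ↪ ℕ) : H →L[ℂ] H :=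
  ((b.orthonormal.comp f f.injective).orthogonalFamily.linearIsometry.comp
    b.repr.toLinearIsometry).toContinuousLinearMap

theorem basisIsometry_apply (f : ℕ ↪ ℕ) (k : ℕ) : basisIsometry b f (b k) = b (f k) := by
  change (b.orthonormal.comp f f.injective).orthogonalFamily.linearIsometry (b.repr (b k)) = _
  rw [b.repr_self, OrthogonalFamily.linearIsometry_apply_single]
  simp

theorem basisIsometry_mul (f g : ℕ ↪ ℕ) :
    basisIsometry b f * basisIsometry b g = basisIsometry b (g.trans f) :=
  b.clm_ext fun k => by
    rw [mul_apply_eq_comp, basisIsometry_apply, basisIsometry_apply, basisIsometry_apply]; rfl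

theorem star_basisIsometry_mul_self (f : ℕ ↪ ℕ) :
    star (basisIsometry b f) * basisIsometry b f = 1 :=
  LinearIsometry.adjoint_comp_self _

theorem star_basisIsometry_apply (f : ℕ ↪ ℕ) (k : ℕ) :
    star (basisIsometry b f) (b (f k)) = b k := by
  rw [← basisIsometry_apply, ← mul_apply_eq_comp, star_basisIsometry_mul_self]; rfl

theorem star_basisIsometry_apply_of_notMem {f : ℕ ↪ ℕ} {k : ℕ} (hk : k ∉ Set.range f) :
    star (basisIsometry b f) (b k) = 0 := by
  refine b.repr.injective (lp.ext (funext fun j => ?_))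
  rw [b.repr_apply_apply, ContinuousLinearMap.star_eq_adjoint,
    ContinuousLinearMap.adjoint_inner_right, basisIsometry_apply, map_zero,
    b.orthonormal.2 fun h => hk ⟨j, h⟩]
  rfl

theorem star_basisIsometry_mul_of_disjoint {f g : ℕ ↪ ℕ} (h : Disjoint (Set.range f) (Set.range g)) :
    star (basisIsometry b f) * basisIsometry b g = 0 :=
  b.clm_ext fun k => by
    rw [mul_apply_eq_comp, basisIsometry_apply, star_basisIsometry_apply_of_notMem]
    · rfl
    · exact Set.disjoint_right.1 h ⟨k, rfl⟩

theorem sum_basisIsometry_mul_star {ι : Type*} [Fintype ι] (f : ι → ℕ ↪ ℕ)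
    (hd : ∀ i j, i ≠ j → Disjoint (Set.range (f i)) (Set.range (f j)))
    (hs : ∀ k, ∃ i q, f i q = k) :
    ∑ i, basisIsometry b (f i) * star (basisIsometry b (f i)) = 1 := by
  refine b.clm_ext fun k => ?_
  obtain ⟨i, q, rfl⟩ := hs k
  rw [sum_apply, Finset.sum_eq_single i]
  · rw [mul_apply_eq_comp, star_basisIsometry_apply, basisIsometry_apply]; rfl
  · intro j _ hj
    rw [mul_apply_eq_comp, star_basisIsometry_apply_of_notMem, map_zero]
    exact Set.disjoint_right.1 (hd j i hj) ⟨q, rfl⟩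
  · simp

end BasisIsometry

/-! ### Matrix algebras generated by isometries -/

section CuntzMatrix

variable {R : Type*} [Ring R] [StarRing R] [Algebra ℂ R] [StarModule ℂ R] {N : ℕ}

/-- Isometries with orthogonal ranges that sum up to `1`. -/
structure IsCuntzFamily (W : Fin N → R) : Prop where
  star_mul_self : ∀ i, star (W i) * W i = 1
  star_mul_of_ne : ∀ i j, i ≠ j → star (W i) * W j = 0
  sum_mul_star : ∑ i, W i * star (W i) = 1

omit [Algebra ℂ R] [StarModule ℂ R] in
theorem IsCuntzFamily.ext {W : Fin N → R} (hW : IsCuntzFamily W) {x y : R}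
    (h : ∀ i, x * W i = y * W i) : x = y := by
  rw [← mul_one x, ← mul_one y, ← hW.sum_mul_star, Finset.mul_sum, Finset.mul_sum]
  exact Finset.sum_congr rfl fun i _ => by rw [← mul_assoc, h, mul_assoc]

omit [StarModule ℂ R] in
theorem IsCuntzFamily.sum_mul {W : Fin N → R} (hW : IsCuntzFamily W)
    (M : Matrix (Fin N) (Fin N) ℂ) (k : Fin N) :
    (∑ j, ∑ i, M i j • (W i * star (W j))) * W k = ∑ i, M i k • W i := by
  rw [Finset.sum_mul, Finset.sum_eq_single k]
  · rw [Finset.sum_mul]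
    exact Finset.sum_congr rfl fun i _ => by
      rw [smul_mul_assoc, mul_assoc, hW.star_mul_self, mul_one]
  · intro j _ hj
    rw [Finset.sum_mul]
    exact Finset.sum_eq_zero fun i _ => by
      rw [smul_mul_assoc, mul_assoc, hW.star_mul_of_ne j k hj, mul_zero, smul_zero]
  · simp

/-- The *-homomorphism sending the matrix units to `W i * star (W j)`. -/
def IsCuntzFamily.matrixHom {W : Fin N → R} (hW : IsCuntzFamily W) :
    Matrix (Fin N) (Fin N) ℂ →⋆ₐ[ℂ] R where
  toFun M := ∑ j, ∑ i, M i j • (W i * star (W j))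
  map_one' := hW.ext fun k => by
    rw [hW.sum_mul, Finset.sum_eq_single k]
    · simp
    · intro i _ hi; simp [Matrix.one_apply_ne hi]
    · simp
  map_mul' M M' := hW.ext fun k => by
    rw [mul_assoc, hW.sum_mul, hW.sum_mul, Finset.mul_sum]
    simp only [mul_smul_comm, hW.sum_mul, Matrix.mul_apply, Finset.sum_smul, Finset.smul_sum,
      smul_smul]
    rw [Finset.sum_comm]
    simp only [mul_comm]
  map_zero' := by simp
  map_add' M M' := by simp [add_smul, Finset.sum_add_distrib]
  commutes' c := hW.ext fun k => by
    rw [hW.sum_mul, Finset.sum_eq_single k]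
    · simp [Algebra.smul_def, Matrix.algebraMap_matrix_apply]
    · intro i _ hi; simp [Matrix.algebraMap_matrix_apply, hi]
    · simp
  map_star' M := by
    simp only [star_sum, star_smul, star_mul, star_star, Matrix.star_apply]
    exact Finset.sum_comm

theorem IsCuntzFamily.matrixHom_mul {W : Fin N → R} (hW : IsCuntzFamily W)
    (M : Matrix (Fin N) (Fin N) ℂ) (k : Fin N) : hW.matrixHom M * W k = ∑ i, M i k • W i :=
  hW.sum_mul M k

theorem IsCuntzFamily.matrixHom_single {W : Fin N → R} (hW : IsCuntzFamily W) (i j : Fin N) :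
    hW.matrixHom (Matrix.single i j 1) = W i * star (W j) := hW.ext fun k => by
  rw [hW.matrixHom_mul, Finset.sum_eq_single i]
  · by_cases h : j = k
    · subst h; rw [mul_assoc, hW.star_mul_self]; simp
    · rw [mul_assoc, hW.star_mul_of_ne j k h]; simp [h]
  · intro l _ hl; simp [Matrix.single_apply_of_row_ne hl.symm]
  · simp

end CuntzMatrix

/-! ### The CAR algebra -/

section CAR

/-- The embedding `q ↦ N * q + i`. -/
def affineEmbedding (N : ℕ) [NeZero N] (i : ℕ) : ℕ ↪ ℕ where
  toFun q := N * q + i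
  inj' _ _ h := Nat.eq_of_mul_eq_mul_left (NeZero.pos N) (Nat.add_right_cancel h)

/-- The embedding `q ↦ q + m`. -/
def shiftEmbedding (m : ℕ) : ℕ ↪ ℕ where
  toFun q := q + m
  inj' _ _ h := Nat.add_right_cancel h

theorem affineEmbedding_apply (N : ℕ) [NeZero N] (i q : ℕ) :
    affineEmbedding N i q = N * q + i := rfl

theorem shiftEmbedding_apply (m q : ℕ) : shiftEmbedding m q = q + m := rfl

theorem affineEmbedding_partition (N : ℕ) [NeZero N] :
    (∀ i j : Fin N, i ≠ j →
      Disjoint (Set.range (affineEmbedding N i)) (Set.range (affineEmbedding N j))) ∧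
    ∀ k, ∃ (i : Fin N) (q : ℕ), affineEmbedding N i q = k := by
  constructor
  · intro i j hij
    refine Set.disjoint_left.2 ?_
    rintro _ ⟨q, rfl⟩ ⟨r, hr⟩
    have h1 := congrArg (· % N) hr
    simp only [affineEmbedding_apply, Nat.mul_add_mod,
      Nat.mod_eq_of_lt i.2, Nat.mod_eq_of_lt j.2] at h1
    exact hij (Fin.ext h1.symm)
  · exact fun k => ⟨⟨k % N, Nat.mod_lt _ (NeZero.pos N)⟩, k / N, Nat.div_add_mod k N⟩

variable {H : Type*} [NormedAddCommGroup H] [InnerProductSpace ℂ H] [CompleteSpace H]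
  (b : HilbertBasis ℕ ℂ H)

theorem isCuntzFamily_affine (N : ℕ) [NeZero N] :
    IsCuntzFamily fun i : Fin N => basisIsometry b (affineEmbedding N i) where
  star_mul_self _ := star_basisIsometry_mul_self b _
  star_mul_of_ne i j h :=
    star_basisIsometry_mul_of_disjoint b ((affineEmbedding_partition N).1 i j h)
  sum_mul_star := sum_basisIsometry_mul_star b _ (affineEmbedding_partition N).1
    (affineEmbedding_partition N).2

/-- The representation of `M_N(ℂ)` by `N × N` blocks with respect to a Hilbert basis. -/
def blockHom (N : ℕ) [NeZero N] : Matrix (Fin N) (Fin N) ℂ →⋆ₐ[ℂ] (H →L[ℂ] H) :=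
  (isCuntzFamily_affine b N).matrixHom

theorem basisIsometry_shift_pow (m : ℕ) :
    basisIsometry b (shiftEmbedding 1) ^ m = basisIsometry b (shiftEmbedding m) := by
  refine b.clm_ext fun k => ?_
  rw [basisIsometry_apply]
  induction m generalizing k with
  | zero => rfl
  | succ m ih =>
    rw [pow_succ, mul_apply_eq_comp, basisIsometry_apply, ih]
    congr 1
    simp only [shiftEmbedding_apply]
    ring

/-- On indices `N q + i`, matrices act on `i` while the `N`-th power of the shift replaces `q` by `q
+ 1`. -/
theorem commute_shift_blockHom (N : ℕ) [NeZero N] (M : Matrix (Fin N) (Fin N) ℂ) :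
    Commute (basisIsometry b (shiftEmbedding 1) ^ N) (blockHom b N M) := by
  have h1 : ∀ i : Fin N, basisIsometry b (shiftEmbedding 1) ^ N *
      basisIsometry b (affineEmbedding N i) =
      basisIsometry b (affineEmbedding N i) * basisIsometry b (shiftEmbedding 1) := fun i => by
    rw [basisIsometry_shift_pow, basisIsometry_mul, basisIsometry_mul]
    congr 1
    ext q
    simp only [affineEmbedding_apply, shiftEmbedding_apply, Function.Embedding.trans_apply]
    ring
  refine (isCuntzFamily_affine b N).ext fun k => ?_
  have h2 := (isCuntzFamily_affine b N).matrixHom_mul M k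
  change blockHom b N M * basisIsometry b (affineEmbedding N k) = _ at h2
  rw [mul_assoc, h2, mul_assoc, h1, ← mul_assoc, h2, Finset.mul_sum, Finset.sum_mul]
  exact Finset.sum_congr rfl fun i _ => by rw [mul_smul_comm, h1, smul_mul_assoc]

/-- Writing `q = K q' + r` turns `N q + i` into `N K q' + (N r + i)`. So a matrix unit of `M_N(ℂ)`
is the sum over `r` of the matrix units of `M_{NK}(ℂ)` joining `N r + j` to `N r + i`. -/
theorem blockHom_range_le {N K L : ℕ} [NeZero N] [NeZero K] [NeZero L] (h : L = N * K) :
    (blockHom b N).range ≤ (blockHom b L).range := by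
  subst h
  rintro _ ⟨M, rfl⟩
  have hlt : ∀ (i : Fin N) (r : Fin K), N * (r : ℕ) + i < N * K := fun i r =>
    calc N * (r : ℕ) + i < N * (r + 1) := by rw [mul_add, mul_one]; exact Nat.add_lt_add_left i.2 _
      _ ≤ N * K := Nat.mul_le_mul_left _ r.2
  have h1 : ∀ (i : Fin N) (r : Fin K), basisIsometry b (affineEmbedding N i) *
      basisIsometry b (affineEmbedding K r) =
      basisIsometry b (affineEmbedding (N * K) (⟨_, hlt i r⟩ : Fin (N * K))) := fun i r => by
    rw [basisIsometry_mul]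
    congr 1
    ext q
    simp only [affineEmbedding_apply, Function.Embedding.trans_apply]
    ring
  have h2 : ∀ i j : Fin N, blockHom b N (Matrix.single i j 1) ∈ (blockHom b (N * K)).range := by
    intro i j
    have h3 : blockHom b N (Matrix.single i j 1) = ∑ r : Fin K, blockHom b (N * K)
        (Matrix.single ⟨_, hlt i r⟩ ⟨_, hlt j r⟩ 1) := by
      simp only [blockHom, IsCuntzFamily.matrixHom_single, ← h1, star_mul]
      conv_lhs => rw [← one_mul (star (basisIsometry b (affineEmbedding N j))),
        ← (isCuntzFamily_affine b K).sum_mul_star, Finset.sum_mul, Finset.mul_sum]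
      exact Finset.sum_congr rfl fun r _ => by simp only [mul_assoc]
    rw [h3]
    exact sum_mem fun r _ => ⟨_, rfl⟩
  rw [Matrix.matrix_eq_sum_single M]
  change blockHom b N _ ∈ (blockHom b (N * K)).range
  rw [map_sum]
  refine sum_mem fun i _ => ?_
  rw [map_sum]
  refine sum_mem fun j _ => ?_
  have h4 : Matrix.single i j (M i j) = M i j • Matrix.single i j (1 : ℂ) := by
    simp [Matrix.smul_single]
  rw [h4, map_smul]
  exact SMulMemClass.smul_mem _ (h2 i j)

theorem blockHom_two_pow_range_mono : Monotone fun n : ℕ => (blockHom b (2 ^ n)).range :=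
  fun n m h => blockHom_range_le b (K := 2 ^ (m - n)) (by rw [← pow_add, Nat.add_sub_cancel' h])

/-- The CAR algebra, acting on a Hilbert space with a basis indexed by `ℕ`. -/
def carSubalgebra : StarSubalgebra ℂ (H →L[ℂ] H) :=
  (⨆ n : ℕ, (blockHom b (2 ^ n)).range).topologicalClosure

instance carSubalgebra_isClosed : IsClosed (carSubalgebra b : Set (H →L[ℂ] H)) :=
  StarSubalgebra.isClosed_topologicalClosure _

theorem blockHom_range_le_carSubalgebra (n : ℕ) : (blockHom b (2 ^ n)).range ≤ carSubalgebra b :=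
  (le_iSup (fun n : ℕ => (blockHom b (2 ^ n)).range) n).trans
    (StarSubalgebra.le_topologicalClosure _)

/-- The embedding of `M_{2^n}(ℂ)` into the CAR algebra. -/
def carHom (n : ℕ) : Matrix (Fin (2 ^ n)) (Fin (2 ^ n)) ℂ →⋆ₐ[ℂ] carSubalgebra b :=
  (blockHom b (2 ^ n)).codRestrict _ fun M => blockHom_range_le_carSubalgebra b n ⟨M, rfl⟩

theorem mem_carHom_range {n : ℕ} {a : carSubalgebra b} :
    a ∈ (carHom b n).range ↔ (a : H →L[ℂ] H) ∈ (blockHom b (2 ^ n)).range := by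
  constructor
  · rintro ⟨M, rfl⟩; exact ⟨M, rfl⟩
  · rintro ⟨M, hM⟩; exact ⟨M, Subtype.ext hM⟩

theorem isCARTower_carHom_range : IsCARTower fun n => (carHom b n).range where
  mono n m h a ha := by
    rw [mem_carHom_range] at ha ⊢
    exact blockHom_two_pow_range_mono b h ha
  iso n := by
    have : Nontrivial H := ⟨b 0, 0, b.orthonormal.ne_zero 0⟩
    have hinj : Function.Injective (carHom b n) :=
      (carHom b n : Matrix (Fin (2 ^ n)) (Fin (2 ^ n)) ℂ →+* carSubalgebra b).injective
    exact ⟨(StarAlgEquiv.ofInjective (carHom b n) hinj).symm⟩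
  dense := by
    refine Subtype.dense_iff.2 fun a ha => ?_
    have h1 : ((⨆ n : ℕ, (blockHom b (2 ^ n)).range : StarSubalgebra ℂ (H →L[ℂ] H)) :
        Set (H →L[ℂ] H)) = ⋃ n : ℕ, ((blockHom b (2 ^ n)).range : Set (H →L[ℂ] H)) :=
      StarSubalgebra.coe_iSup_of_directed (blockHom_two_pow_range_mono b).directed_le
    have h2 : a ∈ closure (⋃ n : ℕ, ((blockHom b (2 ^ n)).range : Set (H →L[ℂ] H))) := by
      rw [← h1]; exact ha
    refine closure_mono ?_ h2
    refine Set.iUnion_subset ?_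
    rintro n _ ⟨M, rfl⟩
    exact ⟨carHom b n M, Set.mem_iUnion.2 ⟨n, M, rfl⟩, rfl⟩

theorem separableSpace_carSubalgebra : TopologicalSpace.SeparableSpace (carSubalgebra b) := by
  have h1 : TopologicalSpace.IsSeparable (⋃ n, ((carHom b n).range : Set (carSubalgebra b))) := by
    refine TopologicalSpace.IsSeparable.iUnion fun n => ?_
    have hc : Continuous (carHom b n) :=
      ((carHom b n : Matrix (Fin (2 ^ n)) (Fin (2 ^ n)) ℂ →ₐ[ℂ]
        carSubalgebra b).toLinearMap).continuous_of_finiteDimensional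
    have : TopologicalSpace.SeparableSpace (Matrix (Fin (2 ^ n)) (Fin (2 ^ n)) ℂ) :=
      inferInstanceAs (TopologicalSpace.SeparableSpace (Fin (2 ^ n) → Fin (2 ^ n) → ℂ))
    have := TopologicalSpace.isSeparable_range hc
    rwa [show ((carHom b n).range : Set (carSubalgebra b)) = Set.range (carHom b n) from rfl]
  have h2 := h1.closure
  rw [(isCARTower_carHom_range b).dense.closure_eq] at h2
  exact TopologicalSpace.isSeparable_univ_iff.1 h2

end CAR

/-! ### The unilateral shift modulo the compact operators -/

section Shift

variable {E : Type*} [NormedAddCommGroup E] [InnerProductSpace ℂ E] [CompleteSpace E]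
  (b : HilbertBasis ℕ ℂ E)

/-- This rank-one defect makes the shift unitary modulo compacts and identifies the kernel of its
adjoint. -/
theorem one_sub_shift_mul_star_apply (x : E) :
    (1 - basisIsometry b (shiftEmbedding 1) * star (basisIsometry b (shiftEmbedding 1))) x =
      inner ℂ (b 0) x • b 0 := by
  have h : 1 - basisIsometry b (shiftEmbedding 1) * star (basisIsometry b (shiftEmbedding 1)) =
      ContinuousLinearMap.smulRight (innerSL ℂ (b 0)) (b 0) := by
    refine b.clm_ext fun k => ?_
    rw [sub_apply, mul_apply_eq_comp, ContinuousLinearMap.smulRight_apply,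
      innerSL_apply_apply]
    change b k - _ = _
    cases k with
    | zero =>
      rw [star_basisIsometry_apply_of_notMem, ContinuousLinearMap.map_zero, sub_zero,
        inner_self_eq_norm_sq_to_K, b.orthonormal.1]
      · simp
      · rintro ⟨q, hq⟩
        simp [shiftEmbedding_apply] at hq
    | succ k =>
      have h1 : b (k + 1) = b (shiftEmbedding 1 k) := rfl
      rw [h1, star_basisIsometry_apply, basisIsometry_apply, sub_self, ← h1,
        b.orthonormal.2 (Nat.succ_ne_zero k).symm, zero_smul]
  rw [h]
  rfl

variable {H : Type*} [NormedAddCommGroup H] [InnerProductSpace ℂ H] [CompleteSpace H]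
  (e : E ≃ₗᵢ[ℂ] H)

/-- The representation of `B(E)` in the Calkin algebra of `H` given by an identification of the
Hilbert spaces `E` and `H`. -/
def calkinRep : (E →L[ℂ] E) →⋆ₐ[ℂ] Calkin H :=
  (Calkin.mkHom H).comp e.conjStarAlgEquiv.toStarAlgHom

/-- The image of the unilateral shift in the Calkin algebra. -/
def calkinShift : Calkin H := calkinRep e (basisIsometry b (shiftEmbedding 1))

theorem calkinShift_mem_unitary : calkinShift b e ∈ unitary (Calkin H) := by
  refine Unitary.mem_iff.2 ⟨?_, ?_⟩
  · rw [calkinShift, ← map_star, ← map_mul, star_basisIsometry_mul_self, map_one]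
  · rw [calkinShift, ← map_star, ← map_mul, ← map_one (calkinRep e), eq_comm]
    refine Calkin.mk_eq_mk_iff.2 ?_
    have h1 : IsCompactOperator (innerSL ℂ (b 0)) :=
      isCompactOperator_of_locallyCompactSpace_dom (innerSL ℂ (b 0))
    have h2 := (h1.comp_clm (e.symm : H →L[ℂ] E)).clm_comp
      (ContinuousLinearMap.toSpanSingleton ℂ (e (b 0)))
    refine (congrArg IsCompactOperator (funext fun x => ?_)).mpr h2
    have h3 := congrArg e (one_sub_shift_mul_star_apply b (e.symm x))
    rw [map_smul] at h3
    exact (map_sub e _ _).symm.trans h3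

/-- The adjoint is used instead: it is surjective with kernel spanned by one basis vector, so its
index is `1`. -/
theorem calkinIndex_calkinShift : calkinIndex (calkinShift b e) = -1 := by
  let S := basisIsometry b (shiftEmbedding 1)
  let T : H →L[ℂ] H := e.conjStarAlgEquiv (star S)
  have hT : ∀ x, T x = e (star S (e.symm x)) := fun x => rfl
  have hs : star (calkinShift b e) = Calkin.mk H T := (map_star (calkinRep e) S).symm
  have hu := isUnit_of_mem_unitary (Unitary.star_mem (calkinShift_mem_unitary b e))
  have h1 : calkinIndex (star (calkinShift b e)) = opIndex T := by
    rw [hs] at hu ⊢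
    exact calkinIndex_mk hu
  have hsurj : Function.Surjective (T : H →ₗ[ℂ] H) := fun y => ⟨e (S (e.symm y)), by
    change T _ = y
    rw [hT, e.symm_apply_apply, ← mul_apply_eq_comp, star_basisIsometry_mul_self]
    exact e.apply_symm_apply y⟩
  have hker : LinearMap.ker (T : H →ₗ[ℂ] H) = Submodule.span ℂ {e (b 0)} := by
    ext x
    rw [Submodule.mem_span_singleton, LinearMap.mem_ker]
    change T x = 0 ↔ _
    constructor
    · intro hx
      rw [hT, e.map_eq_zero_iff] at hx
      refine ⟨inner ℂ (b 0) (e.symm x), ?_⟩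
      rw [← map_smul, ← one_sub_shift_mul_star_apply, sub_apply, mul_apply_eq_comp]
      change e (e.symm x - S (star S (e.symm x))) = x
      rw [hx, map_zero, sub_zero, e.apply_symm_apply]
    · rintro ⟨c, rfl⟩
      rw [map_smul, hT, e.symm_apply_apply, star_basisIsometry_apply_of_notMem, map_zero, smul_zero]
      rintro ⟨q, hq⟩
      simp [shiftEmbedding_apply] at hq
  rw [calkinIndex_star (calkinShift_mem_unitary b e), opIndex,
    LinearMap.index_of_surjective hsurj, hker, finrank_span_singleton] at h1
  · push_cast at h1; linarith
  · rw [Ne, e.map_eq_zero_iff]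
    exact b.orthonormal.ne_zero 0

end Shift

/-! ### Limits of *-homomorphisms -/

section Limits

open Filter

/-- Star homomorphisms of C⋆-algebras are contractive, so eventual constancy on a dense set makes
the sequence Cauchy everywhere. -/
theorem exists_starAlgHom_tendsto {A C : Type*} [CStarAlgebra A] [CStarAlgebra C]
    (φ : ℕ → A →⋆ₐ[ℂ] C) {D : Set A} (hD : Dense D)
    (h : ∀ a ∈ D, ∃ N, ∀ n ≥ N, φ n a = φ N a) :
    ∃ ψ : A →⋆ₐ[ℂ] C, ∀ a, Tendsto (fun n => φ n a) atTop (𝓝 (ψ a)) := by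
  have hnorm : ∀ n a, ‖φ n a‖ ≤ ‖a‖ := fun n a => NonUnitalStarAlgHom.norm_apply_le (φ n) a
  have hlim : ∀ a, ∃ y, Tendsto (fun n => φ n a) atTop (𝓝 y) := by
    intro a
    refine cauchySeq_tendsto_of_complete (Metric.cauchySeq_iff'.2 fun ε hε => ?_)
    obtain ⟨d, hd, hda⟩ := hD.exists_dist_lt a (half_pos hε)
    obtain ⟨N, hN⟩ := h d hd
    refine ⟨N, fun n hn => ?_⟩
    have h1 : φ n a - φ N a = φ n (a - d) - φ N (a - d) := by
      rw [map_sub, map_sub, hN n hn]; abel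
    rw [dist_eq_norm, h1]
    rw [dist_eq_norm] at hda
    linarith [norm_sub_le (φ n (a - d)) (φ N (a - d)), hnorm n (a - d), hnorm N (a - d)]
  choose ψ hψ using hlim
  refine ⟨{ toFun := ψ, map_one' := ?_, map_mul' := ?_, map_zero' := ?_, map_add' := ?_,
            commutes' := ?_, map_star' := ?_ }, hψ⟩
  · exact tendsto_nhds_unique (hψ 1) (by simp)
  · exact fun x y => tendsto_nhds_unique (hψ (x * y)) (by simpa using (hψ x).mul (hψ y))
  · exact tendsto_nhds_unique (hψ 0) (by simp)
  · exact fun x y => tendsto_nhds_unique (hψ (x + y)) (by simpa using (hψ x).add (hψ y))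
  · exact fun c => tendsto_nhds_unique (hψ _) (by simp [AlgHomClass.commutes])
  · exact fun x => tendsto_nhds_unique (hψ (star x)) (by simpa [map_star] using (hψ x).star)

end Limits

/-! ### Two inequivalent extensions of the CAR algebra -/

section Extensions

open Filter

variable {E : Type*} [NormedAddCommGroup E] [InnerProductSpace ℂ E] [CompleteSpace E]
  (b : HilbertBasis ℕ ℂ E)
  {H : Type*} [NormedAddCommGroup H] [InnerProductSpace ℂ H] [CompleteSpace H]
  (e : E ≃ₗᵢ[ℂ] H)

/-- The extension of the CAR algebra given by its representation on the Hilbert space. -/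
def carExt : carSubalgebra b →⋆ₐ[ℂ] Calkin H := (calkinRep e).comp (carSubalgebra b).subtype

theorem commute_calkinShift_pow {n : ℕ} {a : carSubalgebra b} (ha : a ∈ (carHom b n).range) :
    Commute (calkinShift b e ^ 2 ^ n) (carExt b e a) := by
  obtain ⟨M, rfl⟩ := ha
  have := (commute_shift_blockHom b (2 ^ n) M).map (calkinRep e)
  rwa [map_pow] at this

/-- The partial sums `∑_{k < n} 4 ^ k` of the `2`-adic integer `-1/3`. -/
def fourSum (n : ℕ) : ℕ := ∑ k ∈ Finset.range n, 4 ^ k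

theorem three_mul_fourSum (n : ℕ) : 3 * (fourSum n : ℤ) = 4 ^ n - 1 := by
  induction n with
  | zero => simp [fourSum]
  | succ n ih =>
    rw [fourSum, Finset.sum_range_succ, ← fourSum]
    push_cast
    rw [mul_add, ih]
    ring

/-- The conjugates of the extension `carExt` by powers of the shift. -/
def carExtConj (n : ℕ) : carSubalgebra b →⋆ₐ[ℂ] Calkin H :=
  (Unitary.conjStarAlgAut ℂ (Calkin H)
    ⟨calkinShift b e ^ fourSum n, pow_mem (calkinShift_mem_unitary b e) _⟩).toStarAlgHom.comp
      (carExt b e)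

theorem carExtConj_apply (n : ℕ) (a : carSubalgebra b) : carExtConj b e n a =
    calkinShift b e ^ fourSum n * carExt b e a * star (calkinShift b e ^ fourSum n) := rfl

theorem carExtConj_eq_of_mem {n m : ℕ} (hnm : n ≤ m) {a : carSubalgebra b}
    (ha : a ∈ (carHom b n).range) : carExtConj b e m a = carExtConj b e n a := by
  induction m, hnm using Nat.le_induction with
  | base => rfl
  | succ m hnm ih =>
    rw [← ih, carExtConj_apply, carExtConj_apply]
    -- The new factor is `s^(4^m)`, a power of `s^(2^m)`. It commutes with the image of stage `m`,
    -- hence with that of stage `n ≤ m`.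
    have h1 : calkinShift b e ^ fourSum (m + 1) =
        calkinShift b e ^ fourSum m * (calkinShift b e ^ 2 ^ m) ^ 2 ^ m := by
      rw [← pow_mul, ← pow_add, fourSum, Finset.sum_range_succ, ← fourSum, ← mul_pow]
      norm_num
    have h2 : Commute ((calkinShift b e ^ 2 ^ m) ^ 2 ^ m) (carExt b e a) :=
      (commute_calkinShift_pow b e ((isCARTower_carHom_range b).mono hnm ha)).pow_left _
    have h3 : (calkinShift b e ^ 2 ^ m) ^ 2 ^ m ∈ unitary (Calkin H) :=
      pow_mem (pow_mem (calkinShift_mem_unitary b e) _) _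
    rw [h1, star_mul, mul_assoc _ _ (carExt b e a), h2.eq]
    generalize (calkinShift b e ^ 2 ^ m) ^ 2 ^ m = v at h3
    calc _ = calkinShift b e ^ fourSum m * carExt b e a * (v * star v) *
          star (calkinShift b e ^ fourSum m) := by simp only [mul_assoc]
      _ = _ := by rw [Unitary.mul_star_self_of_mem h3, mul_one]

theorem exists_tendsto_carExtConj : ∃ π : carSubalgebra b →⋆ₐ[ℂ] Calkin H,
    ∀ a, Tendsto (fun n => carExtConj b e n a) atTop (𝓝 (π a)) := by
  refine exists_starAlgHom_tendsto _ (isCARTower_carHom_range b).dense fun a ha => ?_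
  obtain ⟨n, hn⟩ := Set.mem_iUnion.1 ha
  exact ⟨n, fun m hm => carExtConj_eq_of_mem b e hm hn⟩

/-- The index of a conjugating unitary would be an integer congruent to `-fourSum n` modulo `2^n`
for every `n`, that is, the 2-adic number `1/3`. -/
theorem not_extSetoid_of_tendsto {π : carSubalgebra b →⋆ₐ[ℂ] Calkin H}
    (hπ : ∀ a, Tendsto (fun n => carExtConj b e n a) atTop (𝓝 (π a))) :
    ¬ (extSetoid (carSubalgebra b) H).r (carExt b e) π := by
  rintro ⟨w, hw, hwπ⟩
  have hdvd : ∀ n : ℕ, ((2 ^ n : ℕ) : ℤ) ∣ -calkinIndex w - fourSum n := by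
    intro n
    have hs : calkinShift b e ^ fourSum n ∈ unitary (Calkin H) :=
      pow_mem (calkinShift_mem_unitary b e) _
    have hx : star w * calkinShift b e ^ fourSum n ∈ unitary (Calkin H) :=
      mul_mem (Unitary.star_mem hw) hs
    have hind : calkinIndex (star w * calkinShift b e ^ fourSum n) =
        -calkinIndex w - fourSum n := by
      rw [calkinIndex_mul (isUnit_of_mem_unitary (Unitary.star_mem hw))
        (isUnit_of_mem_unitary hs), calkinIndex_star hw,
        calkinIndex_pow (isUnit_of_mem_unitary (calkinShift_mem_unitary b e)),
        calkinIndex_calkinShift]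
      ring
    rw [← hind]
    refine dvd_calkinIndex_of_commute
      ((e.conjStarAlgEquiv.toStarAlgHom.comp (blockHom b (2 ^ n)) :
        Matrix (Fin (2 ^ n)) (Fin (2 ^ n)) ℂ →⋆ₐ[ℂ] (H →L[ℂ] H)) :
        Matrix (Fin (2 ^ n)) (Fin (2 ^ n)) ℂ →ₐ[ℂ] (H →L[ℂ] H))
      (isUnit_of_mem_unitary hx) fun M => ?_
    change Commute _ (carExt b e (carHom b n M))
    have ha : carHom b n M ∈ (carHom b n).range := ⟨M, rfl⟩
    generalize carHom b n M = a at ha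
    -- On the `n`-th matrix algebra the sequence is constant from stage `n` on.
    have h1 : π a = carExtConj b e n a :=
      tendsto_nhds_unique (hπ a) (tendsto_atTop_of_eventually_const (i₀ := n)
        fun m hm => carExtConj_eq_of_mem b e hm ha)
    rw [carExtConj_apply, ← hwπ a] at h1
    generalize calkinShift b e ^ fourSum n = v at h1 hs
    have h2 := congrArg (fun y => star w * y * v) h1
    have h3 : star w * (w * carExt b e a * star w) * v = carExt b e a * (star w * v) := by
      calc _ = (star w * w) * carExt b e a * (star w * v) := by simp only [mul_assoc]
        _ = _ := by rw [Unitary.star_mul_self_of_mem hw, one_mul]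
    have h4 : star w * (v * carExt b e a * star v) * v = star w * v * carExt b e a := by
      calc _ = star w * v * carExt b e a * (star v * v) := by simp only [mul_assoc]
        _ = _ := by rw [Unitary.star_mul_self_of_mem hs, mul_one]
    exact (h3.symm.trans (h2.trans h4)).symm
  -- Multiplying by `3` clears the denominator, as `3 * fourSum n = 4 ^ n - 1`.
  have hdvd' : ∀ n : ℕ, ((2 ^ n : ℕ) : ℤ) ∣ 3 * calkinIndex w - 1 := by
    intro n
    have h1 := (hdvd n).mul_left 3
    have h2 : ((2 ^ n : ℕ) : ℤ) ∣ 4 ^ n := ⟨2 ^ n, by push_cast; rw [← mul_pow]; norm_num⟩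
    have h3 : 3 * calkinIndex w - 1 = -(3 * (-calkinIndex w - fourSum n)) - 4 ^ n := by
      have := three_mul_fourSum n
      linarith
    rw [h3]
    exact dvd_sub (dvd_neg.2 h1) h2
  -- An integer `m` divisible by `2 ^ |m|` vanishes, because `|m| < 2 ^ |m|`.
  have h0 : 3 * calkinIndex w - 1 = 0 :=
    Int.eq_zero_of_dvd_of_natAbs_lt_natAbs (hdvd' (3 * calkinIndex w - 1).natAbs) (by
      rw [Int.natAbs_natCast]; exact Nat.lt_two_pow_self)
  omega

end Extensions

/-! ### The intertwining type -/

section IntertwiningType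

open Filter

variable {B C : Type*} [CStarAlgebra B] [CStarAlgebra C]

omit [CStarAlgebra B] in
theorem isDegreeOneType_intertwiningType (π₁ π₂ : B → C) (D : Set B) :
    IsDegreeOneType (intertwiningType π₁ π₂ D) := by
  rintro _ ⟨a, -, rfl⟩
  refine Submodule.sub_mem _ (Submodule.subset_span ?_) (Submodule.subset_span ?_)
  · exact Or.inl (Or.inl ⟨1, (), π₁ a, rfl⟩)
  · exact Or.inl (Or.inl ⟨π₂ a, (), 1, rfl⟩)

/-- The polynomial `x_j c - d x_j`. -/
def intertwiningPoly {ι : Type*} (j : ι) (c d : C) : StarPoly C ι :=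
  StarPoly.coeff 1 * StarPoly.var j * StarPoly.coeff c -
    StarPoly.coeff d * StarPoly.var j * StarPoly.coeff 1

theorem eval_intertwiningPoly {ι : Type*} (j : ι) (c d : C) (u : ι → C) :
    StarPoly.eval u (intertwiningPoly j c d) = u j * c - d * u j := by
  simp [intertwiningPoly, StarPoly.eval, StarPoly.coeff, StarPoly.var]

/-- The conditions `‖x_j π₁(a) - π₂(a) x_j‖ ∈ {0}`. -/
def intertwiningCondition {ι : Type*} (j : ι) (π₁ π₂ : B → C) (a : B) : Condition C ι where
  poly := intertwiningPoly j (π₁ a) (π₂ a)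
  target := {0}
  isCompact_target := isCompact_singleton

theorem mem_cthickening_zero {ε r : ℝ} (hε : 0 ≤ ε) :
    r ∈ Metric.cthickening ε ({0} : Set ℝ) ↔ |r| ≤ ε := by
  rw [Metric.cthickening_singleton _ hε, mem_closedBall_zero_iff, Real.norm_eq_abs]

omit [CStarAlgebra B] in
-- Right multiplication by a unitary is isometric, so `‖u π₁(a) - π₂(a) u‖` equals `‖u π₁(a) u^* -
-- π₂(a)‖`. The index type is arbitrary so as to serve both one variable and a sequence of
-- variables.
theorem exists_epsRealizes_of_tendsto {ι : Type*} (j : ι) {π₁ π₂ : B → C} {D : Set B} {u : ℕ → C}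
    (hu : ∀ n, u n ∈ unitary C)
    (h : ∀ a, Tendsto (fun n => u n * π₁ a * star (u n)) atTop (𝓝 (π₂ a)))
    {F : Set (Condition C ι)} (hF : F ⊆ intertwiningCondition j π₁ π₂ '' D) (hFf : F.Finite)
    {ε : ℝ} (hε : 0 < ε) : ∃ n, EpsRealizes ε (fun _ => u n) F := by
  have hev : ∀ c ∈ F, ∀ᶠ n in atTop,
      ‖StarPoly.eval (fun _ => u n) c.poly‖ ∈ Metric.cthickening ε c.target := by
    intro c hc
    obtain ⟨a, -, rfl⟩ := hF hc
    filter_upwards [Metric.tendsto_nhds.1 (h a) ε hε] with n hn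
    change ‖StarPoly.eval (fun _ => u n) (intertwiningPoly j (π₁ a) (π₂ a))‖ ∈
      Metric.cthickening ε {0}
    rw [mem_cthickening_zero hε.le, abs_norm, eval_intertwiningPoly]
    have h1 : u n * π₁ a - π₂ a * u n = (u n * π₁ a * star (u n) - π₂ a) * u n := by
      rw [sub_mul, mul_assoc _ (star (u n)), Unitary.star_mul_self_of_mem (hu n), mul_one]
    rw [h1, CStarRing.norm_mul_mem_unitary _ (hu n), ← dist_eq_norm]
    exact hn.le
  obtain ⟨n, hn⟩ := ((eventually_all_finite hFf).2 hev).exists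
  exact ⟨n, hn⟩

theorem conj_eq_of_realizes {ι : Type*} (j : ι) {π₁ π₂ : B →⋆ₐ[ℂ] C} {D : Set B} (hD : Dense D)
    {u : ι → C} (hu : u j ∈ unitary C)
    (h : ∀ c ∈ intertwiningCondition j π₁ π₂ '' D, ‖StarPoly.eval u c.poly‖ ∈ c.target) (a : B) :
    u j * π₁ a * star (u j) = π₂ a := by
  have h1 : ∀ a ∈ D, u j * π₁ a = π₂ a * u j := fun a ha => by
    have h2 : ‖StarPoly.eval u (intertwiningPoly j (π₁ a) (π₂ a))‖ ∈ ({0} : Set ℝ) :=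
      h _ ⟨a, ha, rfl⟩
    rw [eval_intertwiningPoly, Set.mem_singleton_iff, norm_eq_zero] at h2
    exact sub_eq_zero.1 h2
  have hc : ∀ π : B →⋆ₐ[ℂ] C, Continuous π := fun π =>
    AddMonoidHomClass.continuous_of_bound π 1
      fun x => by rw [one_mul]; exact NonUnitalStarAlgHom.norm_apply_le π x
  have h3 : (fun a => u j * π₁ a) = fun a => π₂ a * u j :=
    Continuous.ext_on hD (continuous_const.mul (hc π₁)) ((hc π₂).mul continuous_const) h1
  rw [congrFun h3 a, mul_assoc, Unitary.mul_star_self_of_mem hu, mul_one]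

/-- The conditions `‖x_j^* x_j - 1‖ ∈ {0}` and `‖x_j x_j^* - 1‖ ∈ {0}`. -/
def unitaryConditions (C : Type*) [CStarAlgebra C] {ι : Type*} (j : ι) : Set (Condition C ι) :=
  {⟨StarPoly.varStar j * StarPoly.var j - 1, {0}, isCompact_singleton⟩,
    ⟨StarPoly.var j * StarPoly.varStar j - 1, {0}, isCompact_singleton⟩}

theorem mem_unitary_iff_unitaryConditions {ι : Type*} (j : ι) (u : ι → C) :
    u j ∈ unitary C ↔ ∀ c ∈ unitaryConditions C j, ‖StarPoly.eval u c.poly‖ ∈ c.target := by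
  simp [unitaryConditions, StarPoly.eval, StarPoly.var, StarPoly.varStar, Unitary.mem_iff,
    sub_eq_zero]

theorem norm_le_one_of_mem_unitary {u : C} (hu : u ∈ unitary C) : ‖u‖ ≤ 1 := by
  nontriviality C
  exact (CStarRing.norm_of_mem_unitary hu).le

/-- Saturation only provides elements of the unit ball. Adding the unitarity relations for `x_0` to
the intertwining type forces its realizations to be unitary in that variable. -/
theorem not_countablyQuantifierFreeSaturated_of_tendsto {π₁ π₂ : B →⋆ₐ[ℂ] C} {D : Set B}
    (hD : Dense D) (hDc : D.Countable) {u : ℕ → C} (hu : ∀ n, u n ∈ unitary C)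
    (h : ∀ a, Tendsto (fun n => u n * π₁ a * star (u n)) atTop (𝓝 (π₂ a)))
    (hne : ¬ ∃ w ∈ unitary C, ∀ a, w * π₁ a * star w = π₂ a) :
    ¬ CountablyQuantifierFreeSaturated C := by
  intro hsat
  let t : Set (Condition C ℕ) := intertwiningCondition 0 π₁ π₂ '' D ∪ unitaryConditions C 0
  have ht : t.Countable :=
    (hDc.image _).union ((Set.countable_singleton _).insert _)
  obtain ⟨w, -, hw⟩ := (hsat t ht).2 (fun F hF hFf ε hε => by
    obtain ⟨n, hn⟩ := exists_epsRealizes_of_tendsto 0 hu h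
      (F := F ∩ intertwiningCondition 0 π₁ π₂ '' D) Set.inter_subset_right
      (hFf.inter_of_left _) hε
    -- The variables other than `x_0` are unconstrained; a constant tuple suffices.
    refine ⟨fun _ => u n, fun _ => mem_closedBall_zero_iff.2 (norm_le_one_of_mem_unitary (hu n)),
      fun c hc => ?_⟩
    rcases hF hc with hc' | hc'
    · exact hn c ⟨hc, hc'⟩
    · exact Metric.self_subset_cthickening _
        ((mem_unitary_iff_unitaryConditions 0 fun _ => u n).1 (hu n) c hc'))
  have hw0 : w 0 ∈ unitary C :=
    (mem_unitary_iff_unitaryConditions 0 w).2 fun c hc => hw c (Or.inr hc)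
  exact hne ⟨w 0, hw0, conj_eq_of_realizes 0 hD hw0 fun c hc => hw c (Or.inl hc)⟩

end IntertwiningType

end

/-! ### Assembly of the two statements. -/

theorem mainTheorem6 {H : Type*} [NormedAddCommGroup H] [InnerProductSpace ℂ H]
    [CompleteSpace H] [TopologicalSpace.SeparableSpace H] (hH : ¬ FiniteDimensional ℂ H) :
    (∃ t : Set (Condition (Calkin H) Unit),
      t.Countable ∧ IsDegreeOneType t ∧
      FinitelyApproxRealizableIn (unitary (Calkin H) : Set (Calkin H)) t ∧
      ¬ RealizedIn (unitary (Calkin H) : Set (Calkin H)) t ∧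
      ∃ (A : Type) (_ : CStarAlgebra A) (S : ℕ → StarSubalgebra ℂ A)
        (π₁ π₂ : A →⋆ₐ[ℂ] Calkin H) (D : Set A),
        IsCARTower S ∧ (∀ n, HasTrivialExt (S n) H) ∧
        ¬ (extSetoid A H).r π₁ π₂ ∧
        D.Countable ∧ Dense D ∧ t = intertwiningType π₁ π₂ D) ∧
    ¬ CountablyQuantifierFreeSaturated (Calkin H) := by
  obtain ⟨b'⟩ := exists_hilbertBasis_nat H hH
  -- The CAR algebra must live in `Type`, whereas `H` has arbitrary universe. So it is built on the
  -- concrete `ℓ²(ℕ)` and moved to `H` by a unitary.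
  obtain ⟨b⟩ : Nonempty (HilbertBasis ℕ ℂ (lp (fun _ : ℕ => ℂ) 2)) := ⟨default⟩
  obtain ⟨e⟩ : Nonempty (lp (fun _ : ℕ => ℂ) 2 ≃ₗᵢ[ℂ] H) := ⟨b'.repr.symm⟩
  obtain ⟨π, hπ⟩ := exists_tendsto_carExtConj b e
  have hne := not_extSetoid_of_tendsto b e hπ
  have hπ' : ∀ a, Filter.Tendsto (fun n => calkinShift b e ^ fourSum n * carExt b e a *
      star (calkinShift b e ^ fourSum n)) Filter.atTop (𝓝 (π a)) := fun a => by
    simpa only [carExtConj_apply] using hπ a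
  have := separableSpace_carSubalgebra b
  obtain ⟨D, hDc, hD⟩ := TopologicalSpace.exists_countable_dense (carSubalgebra b)
  have hu : ∀ n, calkinShift b e ^ fourSum n ∈ unitary (Calkin H) := fun n =>
    pow_mem (calkinShift_mem_unitary b e) _
  refine ⟨⟨intertwiningType (carExt b e) π D, hDc.image _, isDegreeOneType_intertwiningType _ _ _,
    fun F hF hFf ε hε => ?_, ?_, carSubalgebra b, inferInstance, fun n => (carHom b n).range,
    carExt b e, π, D, isCARTower_carHom_range b, fun n => ?_, hne, hDc, hD, rfl⟩,
    not_countablyQuantifierFreeSaturated_of_tendsto hD hDc hu hπ' hne⟩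
  · obtain ⟨n, hn⟩ := exists_epsRealizes_of_tendsto () hu hπ' hF hFf hε
    exact ⟨fun _ => calkinShift b e ^ fourSum n, fun _ => hu n, hn⟩
  · rintro ⟨w, hw, hwt⟩
    exact hne ⟨w (), hw (), conj_eq_of_realizes () hD (hw ()) hwt⟩
  · obtain ⟨f⟩ := (isCARTower_carHom_range b).iso n
    -- The restriction of `carExt` witnesses that the set of classes is nonempty.
    exact hasTrivialExt_of_matrix hH f ((carExt b e).comp (carHom b n).range.subtype)
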